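/- Corollary 3.2. Let $\alpha>0$, $\alpha\neq1$, let $U^\alpha=\{z\in\mathbb C^2:|z_1|^{2/\alpha}+|z_2|^2<1\}$ carry Lebesgue measure $d\sigma$, and let $A^2(U^\alpha)$ be the Bergman space of square-integrable holomorphic functions on $U^\alpha$, with Bergman projection $P:L^2(U^\alpha)\to A^2(U^\alpha)$ (the orthogonal projection) and Bergman kernel functions $K_z\in A^2(U^\alpha)$, so that $f(z)=\langle f,K_z\rangle$ for all $f\in A^2(U^\alpha)$ and $z\in U^\alpha$. For a measurable symbol $u:U^\alpha\to\mathbb C$ the Toeplitz operator $T_u$ is given by $$T_uf(z)=P(uf)(z)=\int_{U^\alpha}u(w)f(w)\overline{K_z(w)}\,d\sigma(w),$$ and $T_u$ is called bounded on $A^2(U^\alpha)$ if this integral converges absolutely for all $f\in A^2(U^\alpha)$ and $z\in U^\alpha$ and $f\mapsto T_uf$ is a bounded linear operator from $A^2(U^\alpha)$ to itself. For $|z_1|<1$, respectively $|z_2|<1$, and $w\in U^\alpha$ put $$\varphi_{z_2}(w)=\left(w_1\Big(\frac{\sqrt{1-|z_2|^2}}{1-\bar z_2w_2}\Big)^{\alpha},\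 \frac{z_2-w_2}{1-\bar z_2w_2}\right)\quad\text{(principal branch)},$$ $$\phi_{z_1}(w)=\left(m,\ w_2\,\frac{\sqrt{1-|z_1|^2}}{1-\bar z_1w_1}\sqrt{\frac{(1-|w_1|^2)(1-|m|^{2/\alpha})}{(1-|w_1|^{2/\alpha})(1-|m|^2)}}\right),\qquad m=\frac{z_1-w_1}{1-\bar z_1w_1},$$ and for $z\in U^\alpha$ put $f_\alpha(z)=z_1/(1-|z_2|^2)^{\alpha/2}$. (1) If a measurable symbol $u$ satisfies $$\sup_{z\in U^\alpha}\big\|u\circ\varphi_{z_2}\circ\phi_{f_\alpha(z)}\big\|_{L^p(U^\alpha)}<\infty$$ for some $p$ with $4<p\le\infty$, then $T_u$ is bounded on $A^2(U^\alpha)$. (2) In particular, if $u\in L^\infty(U^\alpha)$, then this supremum is finite for every $p$ with $4<p\le\infty$, and $T_u$ is bounded on $A^2(U^\alpha)$. -/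

import Mathlib

open MeasureTheory Metric Set Filter Topology ComplexConjugate

noncomputable section

namespace Bergman

/-! ### Bergman spaces of open sets in `ℂ × ℂ` -/

/-- Mean value property of holomorphic functions over balls of `ℂ × ℂ`. -/
theorem integral_closedBall {Ω : Set (ℂ × ℂ)} {h : ℂ × ℂ → ℂ} (hd : DifferentiableOn ℂ h Ω)
    {z : ℂ × ℂ} {R : ℝ} (hb : closedBall z R ⊆ Ω) (hO : IsOpen Ω) :
    ∫ w in closedBall z R, h w = (volume.real (closedBall z R)) • h z := by
  have hpi : (0 : ℝ) < 2 * Real.pi := by positivity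
  have hHaar : (volume : Measure (ℂ × ℂ)).IsAddHaarMeasure := by
    rw [Measure.volume_eq_prod]; infer_instance
  -- rotations about `z`
  let e : ℝ → ℂ × ℂ → ℂ × ℂ := fun θ w => z + Complex.exp (θ * Complex.I) • (w - z)
  have hnorm : ∀ θ : ℝ, ‖Complex.exp (θ * Complex.I)‖ = 1 := Complex.norm_exp_ofReal_mul_I
  have he_mem : ∀ θ w, e θ w ∈ closedBall z R ↔ w ∈ closedBall z R := by
    intro θ w
    simp only [e, mem_closedBall, dist_eq_norm, add_sub_cancel_left, norm_smul, hnorm, one_mul]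
  have he_mp : ∀ θ, MeasurePreserving (e θ) volume volume := by
    intro θ
    let a : Circle := Circle.exp θ
    have h1 := (rotation a).measurePreserving
    have h2 : MeasurePreserving (fun w : ℂ × ℂ => (rotation a w.1, rotation a w.2))
        volume volume := h1.prod h1
    have h3 : MeasurePreserving (fun w : ℂ × ℂ => w - z) volume volume :=
      measurePreserving_sub_right volume z
    have h4 : MeasurePreserving (fun w : ℂ × ℂ => z + w) volume volume :=
      measurePreserving_add_left volume z
    have := h4.comp (h2.comp h3)
    convert this using 1
    funext w
    ext <;> simp [e, a, Circle.coe_exp]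
  have he_inj : ∀ θ, MeasurableEmbedding (e θ) := by
    intro θ
    have hc : Continuous (e θ) := by fun_prop
    refine hc.measurableEmbedding ?_
    intro x y hxy
    have h0 : Complex.exp (θ * Complex.I) ≠ 0 := Complex.exp_ne_zero _
    simpa [e, h0] using hxy
  have hrot : ∀ θ, ∫ w in closedBall z R, h (e θ w) = ∫ w in closedBall z R, h w := by
    intro θ
    have := (he_mp θ).setIntegral_preimage_emb (he_inj θ) h (closedBall z R)
    rw [← this]
    congr 2
    ext w
    simp [he_mem θ w]
  have havg : ∀ w ∈ closedBall z R, ∫ θ in (0 : ℝ)..2 * Real.pi, h (e θ w) =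
      (2 * Real.pi) • h z := by
    intro w hw
    let g : ℂ → ℂ := fun l => h (z + l • (w - z))
    have hg : DiffContOnCl ℂ g (ball 0 |(1 : ℝ)|) := by
      apply DifferentiableOn.diffContOnCl
      rw [abs_one, closure_ball _ one_ne_zero]
      intro l hl
      have hm : z + l • (w - z) ∈ Ω := by
        apply hb
        simp only [mem_closedBall, dist_eq_norm, add_sub_cancel_left, norm_smul]
        have h1 : ‖l‖ ≤ 1 := by simpa using hl
        have h2 : ‖w - z‖ ≤ R := by simpa [dist_eq_norm] using hw
        nlinarith [norm_nonneg (w - z), norm_nonneg l]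
      have h1 : DifferentiableAt ℂ h (z + l • (w - z)) := hd.differentiableAt (hO.mem_nhds hm)
      have h2 : DifferentiableAt ℂ (fun l : ℂ => z + l • (w - z)) l := by fun_prop
      exact (h1.comp l h2).differentiableWithinAt
    have := hg.circleAverage
    rw [Real.circleAverage_def] at this
    simp only [circleMap, zero_add, g, Complex.ofReal_one, one_mul, zero_smul, add_zero] at this
    rw [← this, smul_smul, mul_inv_cancel₀ hpi.ne', one_smul]
  have hint : Integrable (Function.uncurry fun (θ : ℝ) w => h (e θ w))
      ((volume.restrict (Ioc 0 (2 * Real.pi))).prod (volume.restrict (closedBall z R))) := by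
    rw [Measure.prod_restrict]
    have hk : IsCompact (Icc (0 : ℝ) (2 * Real.pi) ×ˢ closedBall z R) :=
      isCompact_Icc.prod (isCompact_closedBall z R)
    have hc : ContinuousOn (Function.uncurry fun (θ : ℝ) w => h (e θ w))
        (Icc (0 : ℝ) (2 * Real.pi) ×ˢ closedBall z R) := by
      have hcc : Continuous fun q : ℝ × (ℂ × ℂ) => e q.1 q.2 := by fun_prop
      exact hd.continuousOn.comp hcc.continuousOn
        fun q hq => hb ((he_mem q.1 q.2).2 hq.2)
    exact (hc.integrableOn_compact hk).mono_set (prod_mono Ioc_subset_Icc_self le_rfl)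
  have hswap := integral_integral_swap hint
  simp only [hrot] at hswap
  have hr : ∫ w in closedBall z R, ∫ θ in Ioc 0 (2 * Real.pi), h (e θ w) =
      ∫ w in closedBall z R, (2 * Real.pi) • h z := by
    refine setIntegral_congr_fun measurableSet_closedBall fun w hw => ?_
    have := havg w hw
    rw [intervalIntegral.integral_of_le hpi.le] at this
    exact this
  rw [hr] at hswap
  simp only [integral_const, measureReal_restrict_apply MeasurableSet.univ, univ_inter,
    Real.volume_real_Ioc_of_le hpi.le, sub_zero] at hswap
  rw [smul_comm] at hswap
  exact smul_right_injective _ hpi.ne' hswap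

/-- Local bound of a square-integrable holomorphic function by its `L²` norm. -/
theorem exists_norm_le (R : ℝ) (hR : 0 < R) : ∃ C : ℝ, 0 ≤ C ∧ ∀ (Ω : Set (ℂ × ℂ)), IsOpen Ω →
    ∀ h : ℂ × ℂ → ℂ, DifferentiableOn ℂ h Ω → MemLp h 2 (volume.restrict Ω) →
    ∀ z, closedBall z R ⊆ Ω → ‖h z‖ ≤ C * (eLpNorm h 2 (volume.restrict Ω)).toReal := by
  have hHaar : (volume : Measure (ℂ × ℂ)).IsAddHaarMeasure := by
    rw [Measure.volume_eq_prod]; infer_instance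
  set V : ENNReal := volume (closedBall (0 : ℂ × ℂ) R) with hV
  have hV' : ∀ z : ℂ × ℂ, volume (closedBall z R) = V := fun z =>
    Measure.addHaar_closedBall_center volume z R
  have hVtop : V ≠ ⊤ := (isCompact_closedBall (0 : ℂ × ℂ) R).measure_lt_top.ne
  have hV0 : 0 < V.toReal := ENNReal.toReal_pos (measure_closedBall_pos volume _ hR).ne' hVtop
  refine ⟨(V ^ (1 / (1 : ENNReal).toReal - 1 / (2 : ENNReal).toReal)).toReal / V.toReal,
    by positivity, ?_⟩
  intro Ω hO h hd hm z hb
  have hmean := integral_closedBall hd hb hO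
  have hmB : MemLp h 2 (volume.restrict (closedBall z R)) :=
    hm.mono_measure (Measure.restrict_mono hb le_rfl)
  have hfin : IsFiniteMeasure (volume.restrict (closedBall z R)) :=
    ⟨by rw [Measure.restrict_apply_univ, hV']; exact hVtop.lt_top⟩
  have hle := eLpNorm_le_eLpNorm_mul_rpow_measure_univ (p := 1) (q := 2)
    (μ := volume.restrict (closedBall z R)) (by norm_num) hmB.1
  rw [Measure.restrict_apply_univ, hV'] at hle
  have hle2 : eLpNorm h 1 (volume.restrict (closedBall z R)) ≤
      eLpNorm h 2 (volume.restrict Ω) *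
        V ^ (1 / (1 : ENNReal).toReal - 1 / (2 : ENNReal).toReal) :=
    hle.trans (by gcongr)
  have hVr : V ^ (1 / (1 : ENNReal).toReal - 1 / (2 : ENNReal).toReal) ≠ ⊤ :=
    ENNReal.rpow_ne_top_of_nonneg (by norm_num) hVtop
  have hle3 := ENNReal.toReal_mono (ENNReal.mul_ne_top hm.eLpNorm_ne_top hVr) hle2
  rw [ENNReal.toReal_mul] at hle3
  have h1 : ‖∫ w in closedBall z R, h w‖ ≤
      (eLpNorm h 1 (volume.restrict (closedBall z R))).toReal := by
    have hi : Integrable h (volume.restrict (closedBall z R)) := hmB.integrable (by norm_num)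
    rw [eLpNorm_one_eq_lintegral_enorm, ← integral_norm_eq_lintegral_enorm hi.1]
    exact norm_integral_le_integral_norm _
  rw [hmean, norm_smul, Measure.real, hV', Real.norm_of_nonneg hV0.le] at h1
  rw [div_mul_eq_mul_div, le_div_iff₀ hV0]
  nlinarith

/-- Lebesgue measure on `Ω`. -/
abbrev vol (Ω : TopologicalSpace.Opens (ℂ × ℂ)) : Measure (ℂ × ℂ) := volume.restrict Ω

/-- The Bergman space `A²(Ω)`: the classes in `L²(Ω)` that have a holomorphic representative. -/
def space (Ω : TopologicalSpace.Opens (ℂ × ℂ)) : Submodule ℂ (Lp ℂ 2 (vol Ω)) where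
  carrier := {F | ∃ f : ℂ × ℂ → ℂ, DifferentiableOn ℂ f Ω ∧ F =ᵐ[vol Ω] f}
  add_mem' := by
    rintro F G ⟨f, hf, hF⟩ ⟨g, hg, hG⟩
    exact ⟨f + g, hf.add hg, (Lp.coeFn_add F G).trans (hF.add hG)⟩
  zero_mem' := ⟨0, differentiableOn_const 0, Lp.coeFn_zero _ _ _⟩
  smul_mem' := by
    rintro c F ⟨f, hf, hF⟩
    exact ⟨c • f, hf.const_smul c, (Lp.coeFn_smul c F).trans (hF.const_smul c)⟩

variable {Ω : TopologicalSpace.Opens (ℂ × ℂ)}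

/-- The holomorphic function on `Ω` represented by an element of `A²(Ω)`
(its values off `Ω` are irrelevant). -/
def toFun (F : space Ω) : ℂ × ℂ → ℂ := Classical.choose F.2

theorem differentiableOn_toFun (F : space Ω) : DifferentiableOn ℂ (toFun F) Ω :=
  (Classical.choose_spec F.2).1

theorem coe_ae_eq_toFun (F : space Ω) : (F : Lp ℂ 2 (vol Ω)) =ᵐ[vol Ω] toFun F :=
  (Classical.choose_spec F.2).2

theorem toFun_eqOn (F : space Ω) {f : ℂ × ℂ → ℂ} (hf : ContinuousOn f Ω)
    (h : (F : Lp ℂ 2 (vol Ω)) =ᵐ[vol Ω] f) : EqOn (toFun F) f Ω := by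
  have hHaar : (volume : Measure (ℂ × ℂ)).IsAddHaarMeasure := by
    rw [Measure.volume_eq_prod]; infer_instance
  exact Measure.eqOn_open_of_ae_eq ((coe_ae_eq_toFun F).symm.trans h) Ω.isOpen
    (differentiableOn_toFun F).continuousOn hf

theorem memLp_toFun (F : space Ω) : MemLp (toFun F) 2 (vol Ω) :=
  (memLp_congr_ae (coe_ae_eq_toFun F)).1 (Lp.memLp _)

theorem norm_eq_toFun (F : space Ω) : ‖F‖ = (eLpNorm (toFun F) 2 (vol Ω)).toReal := by
  rw [Submodule.coe_norm, Lp.norm_def, eLpNorm_congr_ae (coe_ae_eq_toFun F)]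

theorem toFun_add (F G : space Ω) {z : ℂ × ℂ} (hz : z ∈ Ω) :
    toFun (F + G) z = toFun F z + toFun G z := by
  refine toFun_eqOn (F + G) (f := toFun F + toFun G)
    ((differentiableOn_toFun F).add (differentiableOn_toFun G)).continuousOn ?_ hz
  exact (Lp.coeFn_add _ _).trans ((coe_ae_eq_toFun F).add (coe_ae_eq_toFun G))

theorem toFun_smul (c : ℂ) (F : space Ω) {z : ℂ × ℂ} (hz : z ∈ Ω) :
    toFun (c • F) z = c * toFun F z := by
  refine toFun_eqOn (c • F) (f := c • toFun F)
    ((differentiableOn_toFun F).const_smul c).continuousOn ?_ hz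
  exact (Lp.coeFn_smul _ _).trans ((coe_ae_eq_toFun F).const_smul c)

theorem toFun_sub (F G : space Ω) {z : ℂ × ℂ} (hz : z ∈ Ω) :
    toFun (F - G) z = toFun F z - toFun G z := by
  have h : F - G = F + (-1 : ℂ) • G := by rw [neg_one_smul, sub_eq_add_neg]
  rw [h, toFun_add _ _ hz, toFun_smul _ _ hz]
  ring

/-- Around each point of `Ω`, functions of `A²(Ω)` and their derivatives are bounded by the norm. -/
theorem exists_local_bound {z : ℂ × ℂ} (hz : z ∈ Ω) : ∃ R > 0, ∃ C : ℝ, ball z R ⊆ Ω ∧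
    ∀ F : space Ω, ∀ w ∈ ball z R,
      ‖toFun F w‖ ≤ C * ‖F‖ ∧ ‖fderiv ℂ (toFun F) w‖ ≤ C * ‖F‖ := by
  obtain ⟨r, hr, hb⟩ := Metric.isOpen_iff.1 Ω.isOpen z hz
  have hR : 0 < r / 4 := by positivity
  obtain ⟨C, hC, hbound⟩ := exists_norm_le (r / 4) hR
  have hval : ∀ F : space Ω, ∀ w ∈ ball z (r / 2), ‖toFun F w‖ ≤ C * ‖F‖ := by
    intro F w hw
    rw [norm_eq_toFun]
    refine hbound Ω Ω.isOpen _ (differentiableOn_toFun F) (memLp_toFun F) w ?_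
    refine (closedBall_subset_ball' ?_).trans hb
    have := mem_ball.1 hw
    linarith
  refine ⟨r / 4, hR, max C (2 * C / (r / 4)), (ball_subset_ball (by linarith)).trans hb, ?_⟩
  intro F w hw
  have hsub : ball w (r / 4) ⊆ ball z (r / 2) := by
    refine ball_subset_ball' ?_
    have := mem_ball.1 hw
    linarith
  have hw2 : w ∈ ball z (r / 2) := hsub (mem_ball_self hR)
  constructor
  · exact (hval F w hw2).trans (by gcongr; exact le_max_left _ _)
  · have h1 := Complex.norm_fderiv_le_div_of_mapsTo_ball (f := toFun F) (c := w) (R₁ := r / 4)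
      (R₂ := 2 * (C * ‖F‖))
      ((differentiableOn_toFun F).mono ((hsub.trans (ball_subset_ball (by linarith))).trans hb))
      (by
        intro x hx
        rw [mem_closedBall, dist_eq_norm]
        have h1 := hval F x (hsub hx)
        have h2 := hval F w hw2
        have h3 := norm_sub_le (toFun F x) (toFun F w)
        linarith) hR
    refine h1.trans ?_
    calc 2 * (C * ‖F‖) / (r / 4) = 2 * C / (r / 4) * ‖F‖ := by ring
      _ ≤ _ := by gcongr; exact le_max_right _ _

/-- `A²(Ω)` is closed in `L²(Ω)`. -/
theorem isClosed_space (Ω : TopologicalSpace.Opens (ℂ × ℂ)) :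
    IsClosed (space Ω : Set (Lp ℂ 2 (vol Ω))) := by
  refine IsSeqClosed.isClosed ?_
  intro G F hG hlim
  let H : ℕ → space Ω := fun n => ⟨G n, hG n⟩
  have hcs : CauchySeq H := by
    refine Metric.cauchySeq_iff.2 fun ε hε => ?_
    exact Metric.cauchySeq_iff.1 hlim.cauchySeq ε hε
  have hcauchy : ∀ z ∈ Ω, ∃ R > 0, ball z R ⊆ Ω ∧
      (∀ w ∈ ball z R, CauchySeq fun n => toFun (H n) w) ∧
      UniformCauchySeqOn (fun n => fderiv ℂ (toFun (H n))) atTop (ball z R) := by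
    intro z hz
    obtain ⟨R, hR, C, hb, hC⟩ := exists_local_bound hz
    have hC' : ∀ ε > 0, ∃ N, ∀ m ≥ N, ∀ n ≥ N, C * ‖H m - H n‖ < ε := by
      intro ε hε
      obtain ⟨N, hN⟩ := Metric.cauchySeq_iff.1 hcs (ε / (|C| + 1)) (by positivity)
      refine ⟨N, fun m hm n hn => ?_⟩
      have h1 := hN m hm n hn
      rw [dist_eq_norm, lt_div_iff₀ (by positivity)] at h1
      have h2 := le_abs_self C
      have h3 := norm_nonneg (H m - H n)
      nlinarith
    refine ⟨R, hR, hb, ?_, ?_⟩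
    · intro w hw
      refine Metric.cauchySeq_iff.2 fun ε hε => ?_
      obtain ⟨N, hN⟩ := hC' ε hε
      refine ⟨N, fun m hm n hn => ?_⟩
      rw [dist_eq_norm, ← toFun_sub _ _ (hb hw)]
      exact ((hC _ w hw).1).trans_lt (hN m hm n hn)
    · refine Metric.uniformCauchySeqOn_iff.2 fun ε hε => ?_
      obtain ⟨N, hN⟩ := hC' ε hε
      refine ⟨N, fun m hm n hn w hw => ?_⟩
      have hO : (Ω : Set (ℂ × ℂ)) ∈ 𝓝 w := Ω.isOpen.mem_nhds (hb hw)
      have hev : toFun (H m - H n) =ᶠ[𝓝 w] toFun (H m) - toFun (H n) := by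
        filter_upwards [hO] with x hx
        exact toFun_sub _ _ hx
      have hd := hev.fderiv_eq (𝕜 := ℂ)
      rw [fderiv_sub ((differentiableOn_toFun _).differentiableAt hO)
        ((differentiableOn_toFun _).differentiableAt hO)] at hd
      rw [dist_eq_norm, ← hd]
      exact ((hC _ w hw).2).trans_lt (hN m hm n hn)
  have hex : ∀ z, ∃ a : ℂ, z ∈ Ω → Tendsto (fun n => toFun (H n) z) atTop (𝓝 a) := by
    intro z
    by_cases hz : z ∈ Ω
    · obtain ⟨R, hR, -, h1, -⟩ := hcauchy z hz
      obtain ⟨a, ha⟩ := cauchySeq_tendsto_of_complete (h1 z (mem_ball_self hR))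
      exact ⟨a, fun _ => ha⟩
    · exact ⟨0, fun h => absurd h hz⟩
  choose g hg using hex
  refine ⟨g, ?_, ?_⟩
  · intro z hz
    obtain ⟨R, hR, hb, -, h2⟩ := hcauchy z hz
    have hex' : ∀ w, ∃ L : ℂ × ℂ →L[ℂ] ℂ, w ∈ ball z R →
        Tendsto (fun n => fderiv ℂ (toFun (H n)) w) atTop (𝓝 L) := by
      intro w
      by_cases hw : w ∈ ball z R
      · obtain ⟨L, hL⟩ := cauchySeq_tendsto_of_complete (h2.cauchySeq hw)
        exact ⟨L, fun _ => hL⟩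
      · exact ⟨0, fun h => absurd h hw⟩
    choose g' hg' using hex'
    have hfd := hasFDerivAt_of_tendstoUniformlyOn (𝕜 := ℂ) (f := fun n => toFun (H n)) (g := g)
      (x := z) isOpen_ball
      (h2.tendstoUniformlyOn_of_tendsto hg')
      (fun n x hx => ((differentiableOn_toFun (H n)).differentiableAt
        (Ω.isOpen.mem_nhds (hb hx))).hasFDerivAt)
      (fun x hx => hg x (hb hx)) (mem_ball_self hR)
    exact hfd.differentiableAt.differentiableWithinAt
  · obtain ⟨ns, hns, hae⟩ := (tendstoInMeasure_of_tendsto_Lp hlim).exists_seq_tendsto_ae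
    have hall : ∀ᵐ x ∂vol Ω, ∀ n, (H n : Lp ℂ 2 (vol Ω)) x = toFun (H n) x :=
      ae_all_iff.2 fun n => coe_ae_eq_toFun (H n)
    filter_upwards [hae, hall, ae_restrict_mem Ω.isOpen.measurableSet] with x h1 h2 hx
    refine tendsto_nhds_unique h1 ?_
    have h3 := (hg x hx).comp hns.tendsto_atTop
    refine h3.congr fun i => ?_
    exact (h2 (ns i)).symm

instance : CompleteSpace (space Ω) := (isClosed_space Ω).completeSpace_coe

/-- The Bergman projection: the orthogonal projection of `L²(Ω)` onto `A²(Ω)`. -/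
def projection (Ω : TopologicalSpace.Opens (ℂ × ℂ)) : Lp ℂ 2 (vol Ω) →L[ℂ] space Ω :=
  (space Ω).orthogonalProjectionOnto

/-- Evaluation of functions of `A²(Ω)` at a point of `Ω`, a bounded functional. -/
def eval (z : Ω) : space Ω →L[ℂ] ℂ :=
  LinearMap.mkContinuousOfExistsBound
    { toFun := fun F => toFun F z
      map_add' := fun F G => toFun_add F G z.2
      map_smul' := fun c F => toFun_smul c F z.2 }
    (by
      obtain ⟨R, hR, C, -, hC⟩ := exists_local_bound z.2
      exact ⟨C, fun F => (hC F z (mem_ball_self hR)).1⟩)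

/-- The Bergman kernel function `K_z = K_Ω(·; z̄)`: the element of `A²(Ω)`
with `f(z) = ⟨f, K_z⟩` for all `f` in `A²(Ω)`. -/
def kernel (z : Ω) : space Ω := (InnerProductSpace.toDual ℂ (space Ω)).symm (eval z)

/-- The reproducing property (Mathlib's inner product is conjugate-linear in the first entry). -/
theorem inner_kernel (z : Ω) (F : space Ω) : inner ℂ (kernel z) F = toFun F z :=
  InnerProductSpace.toDual_symm_apply

/-- The integrand of `P(g)(z) = ∫ g(w) ⟨K_w, K_z⟩ dσ(w)`, where `⟨K_w, K_z⟩` is the conjugate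
of `K_z(w)`. -/
def projIntegrand (g : ℂ × ℂ → ℂ) (z : Ω) (w : ℂ × ℂ) : ℂ := g w * conj (toFun (kernel z) w)

/-- The integral form of the Bergman projection agrees with the orthogonal projection on `L²(Ω)`. -/
theorem integral_projIntegrand {g : ℂ × ℂ → ℂ} (hg : MemLp g 2 (vol Ω)) (z : Ω) :
    Integrable (projIntegrand g z) (vol Ω) ∧
      ∫ w in Ω, projIntegrand g z w = toFun (projection Ω (hg.toLp g)) z := by
  have hae : (fun w => inner ℂ (((kernel z : space Ω) : Lp ℂ 2 (vol Ω)) w) (hg.toLp g w))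
      =ᵐ[vol Ω] projIntegrand g z := by
    filter_upwards [coe_ae_eq_toFun (kernel z), hg.coeFn_toLp] with w h1 h2
    rw [h1, h2, RCLike.inner_apply, projIntegrand]
  refine ⟨(L2.integrable_inner _ _).congr hae, ?_⟩
  rw [← inner_kernel, projection]
  rw [Submodule.inner_orthogonalProjectionOnto_eq_of_mem_left, L2.inner_def]
  exact (integral_congr_ae hae).symm

/-- The Toeplitz operator with symbol `u`, in the form
`T_u f(z) = P(u f)(z) = ∫ u(w) f(w) ⟨K_w, K_z⟩ dσ(w)`, which makes sense for unbounded `u`. -/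
def toeplitz (u : ℂ × ℂ → ℂ) (f : space Ω) (z : Ω) : ℂ :=
  ∫ w in Ω, projIntegrand (fun w => u w * toFun f w) z w

/-- `T_u` is bounded on `A²(Ω)`: for each `f` in `A²(Ω)` and `z` in `Ω` the integral defining
`T_u f(z)` converges absolutely, and `T_u` is a bounded linear operator from `A²(Ω)` to itself. -/
def ToeplitzBounded (Ω : TopologicalSpace.Opens (ℂ × ℂ)) (u : ℂ × ℂ → ℂ) : Prop :=
  (∀ (f : space Ω) (z : Ω), Integrable (projIntegrand (fun w => u w * toFun f w) z) (vol Ω)) ∧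
    ∃ T : space Ω →L[ℂ] space Ω, ∀ (f : space Ω) (z : Ω), toFun (T f) z = toeplitz u f z

/-- Whenever `u f ∈ L²(Ω)`, `T_u f` is the orthogonal projection of `u f`; in particular
`T_u = P M_u` for bounded `u`. -/
theorem toeplitz_eq_projection (u : ℂ × ℂ → ℂ) (f : space Ω)
    (h : MemLp (fun w => u w * toFun f w) 2 (vol Ω)) (z : Ω) :
    toeplitz u f z = toFun (projection Ω (h.toLp _)) z :=
  (integral_projIntegrand h z).2

end Bergman

/-! ### The Thullen domain and its automorphisms -/

namespace Thullen

/-- The Thullen domain `U^α = {|z₁|^(2/α) + |z₂|² < 1}`. -/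
def domain (α : ℝ) (hα : 0 < α) : TopologicalSpace.Opens (ℂ × ℂ) where
  carrier := {z | ‖z.1‖ ^ (2 / α) + ‖z.2‖ ^ 2 < 1}
  is_open' := by
    have h : 0 ≤ 2 / α := by positivity
    have hc : Continuous fun z : ℂ × ℂ => ‖z.1‖ ^ (2 / α) + ‖z.2‖ ^ 2 :=
      ((Real.continuous_rpow_const h).comp (by fun_prop)).add (by fun_prop)
    exact isOpen_lt hc continuous_const

/-- The holomorphic automorphism `φ_{z₂}` (principal branch of the power: its base has positive
real part for `|z₂|, |w₂| < 1`). -/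
def autHol (α : ℝ) (z₂ : ℂ) (w : ℂ × ℂ) : ℂ × ℂ :=
  (w.1 * ((√(1 - ‖z₂‖ ^ 2) : ℝ) / (1 - conj z₂ * w.2)) ^ (α : ℂ),
    (z₂ - w.2) / (1 - conj z₂ * w.2))

/-- The disc automorphism `w₁ ↦ (z₁ - w₁) / (1 - z̄₁ w₁)`, the first component of `ϕ_{z₁}`. -/
def moebius (z₁ w₁ : ℂ) : ℂ := (z₁ - w₁) / (1 - conj z₁ * w₁)

/-- The (in general not holomorphic) automorphism `ϕ_{z₁}`. -/
def aut (α : ℝ) (z₁ : ℂ) (w : ℂ × ℂ) : ℂ × ℂ :=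
  (moebius z₁ w.1,
    w.2 * ((√(1 - ‖z₁‖ ^ 2) : ℝ) / (1 - conj z₁ * w.1)) *
      (√(((1 - ‖w.1‖ ^ 2) * (1 - ‖moebius z₁ w.1‖ ^ (2 / α))) /
        ((1 - ‖w.1‖ ^ (2 / α)) * (1 - ‖moebius z₁ w.1‖ ^ 2))) : ℝ))

/-- `f_α(z) = z₁ / (1 - |z₂|²)^(α/2)`. -/
def fα (α : ℝ) (z : ℂ × ℂ) : ℂ := z.1 / ((1 - ‖z.2‖ ^ 2) ^ (α / 2) : ℝ)

/-- The composition `φ_{z₂} ∘ ϕ_{f_α(z)}`, which takes the origin to `z`. -/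
def translation (α : ℝ) (z w : ℂ × ℂ) : ℂ × ℂ := autHol α z.2 (aut α (fα α z) w)

/-- `sup_{z ∈ U^α} ‖u ∘ φ_{z₂} ∘ ϕ_{f_α(z)}‖_{L^p(U^α)}`. -/
def supNorm (α : ℝ) (hα : 0 < α) (u : ℂ × ℂ → ℂ) (p : ENNReal) : ENNReal :=
  ⨆ z ∈ domain α hα, eLpNorm (fun w => u (translation α z w)) p (Bergman.vol (domain α hα))

end Thullen

end

/-! ### Automorphisms of the unit disc. -/

namespace Thullen

/-! It suffices that `|u| dσ` is a Carleson measure for the Bergman space: `∫ |f|²|u| ≤ C‖f‖²`.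
Cauchy–Schwarz then bounds the sesquilinear form `∫ u f ḡ`, Riesz representation turns it into a
bounded operator, and testing against `K_z` identifies this operator with `T_u`
(`toeplitzBounded_of_carleson`).

The Carleson bound rests on regions adapted to the domain. The region `Near` around `z` is the image
under `autHol α z.2` of a polydisc about `(fα α z, 0)` with radii of order `1 - |fα α z|` and its
square root; it has volume of order `V(z) = nearVol α z`. Three facts carry the argument: - the mean
value property gives `V(z)|f(z)|² ≲ ∫ |f|²` over this region (`exists_nearVol_mul_sq_le`); -
nearness is symmetric up to enlarging the polydisc, with `V(w) ≲ V(z)` for `w` near `z`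
(`Near.symm`); - pulled back by the translation taking `0` to `w`, the region around `w` lies where
the Jacobian is `≲ V(w)`, so `∫ |u|` over it is `≲ V(w)` times the `L¹` norm of the translated
symbol (`exists_lintegral_near_le`).

Multiplying the first estimate by `|u(z)|`, integrating and exchanging the integrals, the factors
`V(w)` cancel (`exists_carleson_bound`). Since the domain has finite volume, an `L^p` bound on the
translates of `u` supplies the `L¹` bound. For bounded `u` the translates are uniformly bounded,
because translations preserve the domain and pull null sets back to null sets. -/

theorem one_sub_conj_mul_ne_zero {a w : ℂ} (ha : ‖a‖ < 1) (hw : ‖w‖ < 1) :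
    1 - conj a * w ≠ 0 := by
  intro h
  have h1 : ‖conj a * w‖ = 1 := by rw [← sub_eq_zero.1 h, norm_one]
  rw [norm_mul, RCLike.norm_conj] at h1
  nlinarith [norm_nonneg a, norm_nonneg w]

theorem norm_one_sub_conj_mul_pos {a w : ℂ} (ha : ‖a‖ < 1) (hw : ‖w‖ < 1) :
    0 < ‖1 - conj a * w‖ := norm_pos_iff.2 (one_sub_conj_mul_ne_zero ha hw)

theorem one_sub_sq_norm_pos {a : ℂ} (ha : ‖a‖ < 1) : 0 < 1 - ‖a‖ ^ 2 := by
  nlinarith [norm_nonneg a]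

theorem one_sub_sq_norm_moebius {a w : ℂ} (ha : ‖a‖ < 1) (hw : ‖w‖ < 1) :
    1 - ‖moebius a w‖ ^ 2 = (1 - ‖a‖ ^ 2) * (1 - ‖w‖ ^ 2) / ‖1 - conj a * w‖ ^ 2 := by
  have h := norm_one_sub_conj_mul_pos ha hw
  rw [moebius, norm_div, div_pow, eq_div_iff (by positivity), sub_mul,
    div_mul_cancel₀ _ (by positivity)]
  simp only [← Complex.normSq_eq_norm_sq, Complex.normSq_apply, Complex.sub_re, Complex.sub_im,
    Complex.mul_re, Complex.mul_im, Complex.conj_re, Complex.conj_im, Complex.one_re,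
    Complex.one_im]
  ring

theorem norm_moebius_lt_one {a w : ℂ} (ha : ‖a‖ < 1) (hw : ‖w‖ < 1) : ‖moebius a w‖ < 1 := by
  have h := one_sub_sq_norm_moebius ha hw
  have h1 : 0 < (1 - ‖a‖ ^ 2) * (1 - ‖w‖ ^ 2) / ‖1 - conj a * w‖ ^ 2 :=
    div_pos (mul_pos (one_sub_sq_norm_pos ha) (one_sub_sq_norm_pos hw))
      (pow_pos (norm_one_sub_conj_mul_pos ha hw) 2)
  nlinarith [norm_nonneg (moebius a w)]

/-- This identity is what makes `moebius a` an involution, and what makes the fibre factors of both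
automorphisms at `w` and `moebius a w` mutually inverse. -/
theorem one_sub_conj_mul_moebius {a w : ℂ} (ha : ‖a‖ < 1) (hw : ‖w‖ < 1) :
    (1 - conj a * w) * (1 - conj a * moebius a w) = ((1 - ‖a‖ ^ 2 : ℝ) : ℂ) := by
  have h := one_sub_conj_mul_ne_zero ha hw
  have h2 : conj a * a = (‖a‖ : ℂ) ^ 2 := Complex.conj_mul' a
  rw [moebius]
  push_cast
  rw [← h2]
  field_simp
  ring

theorem moebius_moebius {a w : ℂ} (ha : ‖a‖ < 1) (hw : ‖w‖ < 1) :
    moebius a (moebius a w) = w := by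
  have h := one_sub_conj_mul_ne_zero ha hw
  have h1 := one_sub_conj_mul_moebius ha hw
  have h2 : conj a * a = (‖a‖ : ℂ) ^ 2 := Complex.conj_mul' a
  have h3 : 1 - conj a * moebius a w ≠ 0 :=
    one_sub_conj_mul_ne_zero ha (norm_moebius_lt_one ha hw)
  have h4 : (1 - conj a * w) * (a - moebius a w) = w * ((1 - ‖a‖ ^ 2 : ℝ) : ℂ) := by
    have : (1 - conj a * w) * moebius a w = a - w := by
      rw [moebius, mul_div_cancel₀ _ h]
    push_cast
    rw [mul_sub, this, ← h2]
    ring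
  rw [moebius, div_eq_iff h3]
  apply mul_left_cancel₀ h
  rw [h4, ← h1]
  ring

theorem norm_moebius_comm (a w : ℂ) : ‖moebius a w‖ = ‖moebius w a‖ := by
  rw [moebius, moebius, norm_div, norm_div, norm_sub_rev, ← RCLike.norm_conj (1 - conj a * w)]
  congr 2
  simp [mul_comm]

theorem hasDerivAt_moebius {a w : ℂ} (ha : ‖a‖ < 1) (hw : ‖w‖ < 1) :
    HasDerivAt (moebius a) (-((1 - ‖a‖ ^ 2 : ℝ) : ℂ) / (1 - conj a * w) ^ 2) w := by
  have h := one_sub_conj_mul_ne_zero ha hw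
  have h1 : HasDerivAt (fun w => a - w) (-1) w := (hasDerivAt_id w).const_sub a
  have h2 : HasDerivAt (fun w => 1 - conj a * w) (-(conj a * 1)) w :=
    ((hasDerivAt_id w).const_mul (conj a)).const_sub 1
  have h3 := h1.div h2 h
  have h4 : conj a * a = (‖a‖ : ℂ) ^ 2 := Complex.conj_mul' a
  refine h3.congr_deriv ?_
  push_cast
  rw [← h4]
  ring

/-- The modulus of the derivative of `moebius a` at `w`. -/
noncomputable def moebiusJac (a w : ℂ) : ℝ := (1 - ‖a‖ ^ 2) / ‖1 - conj a * w‖ ^ 2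

theorem moebiusJac_pos {a w : ℂ} (ha : ‖a‖ < 1) (hw : ‖w‖ < 1) : 0 < moebiusJac a w :=
  div_pos (one_sub_sq_norm_pos ha) (pow_pos (norm_one_sub_conj_mul_pos ha hw) 2)

/-! ### Changes of variables in the disc and in disc bundles. -/

theorem abs_det_toSpanSingleton (c : ℂ) :
    |(((ContinuousLinearMap.toSpanSingleton ℂ c).restrictScalars ℝ : ℂ →L[ℝ] ℂ)).det|
      = ‖c‖ ^ 2 := by
  have h : (((ContinuousLinearMap.toSpanSingleton ℂ c).restrictScalars ℝ : ℂ →L[ℝ] ℂ) :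
      ℂ →ₗ[ℝ] ℂ) = Algebra.lmul ℝ ℂ c := by
    ext; simp [mul_comm]
  rw [ContinuousLinearMap.det, h, ← Algebra.norm_apply, Algebra.norm_complex_eq]
  simp [Complex.normSq_eq_norm_sq]

theorem moebius_image_ball {a : ℂ} (ha : ‖a‖ < 1) : moebius a '' ball 0 1 = ball 0 1 := by
  ext y
  constructor
  · rintro ⟨w, hw, rfl⟩
    rw [mem_ball_zero_iff] at hw ⊢
    exact norm_moebius_lt_one ha hw
  · intro hy
    rw [mem_ball_zero_iff] at hy
    exact ⟨moebius a y, mem_ball_zero_iff.2 (norm_moebius_lt_one ha hy), moebius_moebius ha hy⟩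

theorem lintegral_comp_moebius {a : ℂ} (ha : ‖a‖ < 1) (g : ℂ → ENNReal) :
    ∫⁻ w in ball (0 : ℂ) 1, ENNReal.ofReal (moebiusJac a w ^ 2) * g (moebius a w) =
      ∫⁻ w in ball (0 : ℂ) 1, g w := by
  have hinj : InjOn (moebius a) (ball 0 1) := fun x hx y hy h => by
    rw [← moebius_moebius ha (mem_ball_zero_iff.1 hx), h,
      moebius_moebius ha (mem_ball_zero_iff.1 hy)]
  have h := lintegral_image_eq_lintegral_abs_det_fderiv_mul (volume : Measure ℂ)
    (s := ball (0 : ℂ) 1) (f := moebius a)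
    (f' := fun w => (ContinuousLinearMap.toSpanSingleton ℂ
      (-((1 - ‖a‖ ^ 2 : ℝ) : ℂ) / (1 - conj a * w) ^ 2)).restrictScalars ℝ)
    measurableSet_ball
    (fun w hw => ((hasDerivAt_moebius ha
      (mem_ball_zero_iff.1 hw)).hasFDerivAt.restrictScalars ℝ).hasFDerivWithinAt) hinj g
  rw [moebius_image_ball ha] at h
  rw [h]
  refine lintegral_congr fun w => ?_
  rw [abs_det_toSpanSingleton, moebiusJac, norm_div, norm_neg, Complex.norm_real, norm_pow,
    div_pow, div_pow, Real.norm_eq_abs, sq_abs]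

theorem lintegral_comp_mul_right {k : ℂ} (hk : k ≠ 0) (g : ℂ → ENNReal) :
    ∫⁻ y, ENNReal.ofReal (‖k‖ ^ 2) * g (y * k) = ∫⁻ y, g y := by
  have hinj : InjOn (fun y => y * k) univ := fun x _ y _ h => mul_right_cancel₀ hk h
  have h := lintegral_image_eq_lintegral_abs_det_fderiv_mul (volume : Measure ℂ)
    (s := univ) (f := fun y => y * k)
    (f' := fun w => (ContinuousLinearMap.toSpanSingleton ℂ k).restrictScalars ℝ)
    MeasurableSet.univ
    (fun w _ => (((hasDerivAt_mul_const k).hasFDerivAt).restrictScalars ℝ).hasFDerivWithinAt)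
    hinj g
  have him : (fun y => y * k) '' univ = univ := by
    rw [image_univ]
    exact (mul_right_surjective₀ hk).range_eq
  rw [him] at h
  simp only [Measure.restrict_univ, abs_det_toSpanSingleton] at h
  exact h.symm

theorem measurable_moebius (a : ℂ) : Measurable (moebius a) := by
  unfold moebius
  fun_prop

/-- Change of variables for a disc automorphism in the base and a complex scaling in the fibre. -/
theorem lintegral_comp_fibre {a : ℂ} (ha : ‖a‖ < 1) {k : ℂ → ℂ} (hk : Measurable k)
    (hk0 : ∀ w, ‖w‖ < 1 → k w ≠ 0) {g : ℂ × ℂ → ENNReal} (hg : Measurable g) :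
    ∫⁻ w in ball (0 : ℂ) 1 ×ˢ univ,
      ENNReal.ofReal ((moebiusJac a w.1 * ‖k w.1‖) ^ 2) * g (moebius a w.1, w.2 * k w.1) =
      ∫⁻ w in ball (0 : ℂ) 1 ×ˢ univ, g w := by
  have hm := measurable_moebius a
  have hJ : Measurable (moebiusJac a) := by unfold moebiusJac; fun_prop
  -- The map is triangular, so Tonelli separates base and fibre. Hence `k` need only be measurable,
  -- and nothing is differentiated in the non-holomorphic direction.
  rw [Measure.volume_eq_prod, ← Measure.prod_restrict, Measure.restrict_univ,
    lintegral_prod _ (by fun_prop), lintegral_prod _ hg.aemeasurable,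
    ← lintegral_comp_moebius ha fun x => ∫⁻ y, g (x, y)]
  refine setLIntegral_congr_fun measurableSet_ball fun w hw => ?_
  have hw' := hk0 w (mem_ball_zero_iff.1 hw)
  rw [← lintegral_comp_mul_right hw' fun y => g (moebius a w, y), ← lintegral_const_mul _
    (by fun_prop)]
  refine lintegral_congr fun y => ?_
  rw [mul_pow, ENNReal.ofReal_mul (by positivity), mul_assoc]

theorem lintegral_comp_fibre_swap {a : ℂ} (ha : ‖a‖ < 1) {k : ℂ → ℂ} (hk : Measurable k)
    (hk0 : ∀ w, ‖w‖ < 1 → k w ≠ 0) {g : ℂ × ℂ → ENNReal} (hg : Measurable g) :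
    ∫⁻ w in univ ×ˢ ball (0 : ℂ) 1,
      ENNReal.ofReal ((moebiusJac a w.2 * ‖k w.2‖) ^ 2) * g (w.1 * k w.2, moebius a w.2) =
      ∫⁻ w in univ ×ˢ ball (0 : ℂ) 1, g w := by
  have h := lintegral_comp_fibre ha hk hk0 (hg.comp measurable_swap)
  have hmp : MeasurePreserving (Prod.swap : ℂ × ℂ → ℂ × ℂ) volume volume :=
    Measure.measurePreserving_swap
  have key : ∀ G : ℂ × ℂ → ENNReal, ∫⁻ w in univ ×ˢ ball (0 : ℂ) 1, G w =
      ∫⁻ w in ball (0 : ℂ) 1 ×ˢ univ, G w.swap := by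
    intro G
    have h1 := hmp.setLIntegral_comp_preimage_emb MeasurableEquiv.prodComm.measurableEmbedding G
      (univ ×ˢ ball (0 : ℂ) 1)
    rw [← h1, preimage_swap_prod]
  rw [key, key]
  exact h

/-! ### The two automorphisms as involutions of the domain. -/

/-- The fibre factor of `autHol`. -/
noncomputable def holFactor (α : ℝ) (c y : ℂ) : ℂ :=
  ((√(1 - ‖c‖ ^ 2) : ℝ) / (1 - conj c * y)) ^ (α : ℂ)

/-- The fibre factor of `aut`. -/
noncomputable def autFactor (α : ℝ) (a x : ℂ) : ℂ :=
  (√(1 - ‖a‖ ^ 2) : ℝ) / (1 - conj a * x) *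
    (√(((1 - ‖x‖ ^ 2) * (1 - ‖moebius a x‖ ^ (2 / α))) /
        ((1 - ‖x‖ ^ (2 / α)) * (1 - ‖moebius a x‖ ^ 2))) : ℝ)

theorem autHol_eq (α : ℝ) (c : ℂ) (w : ℂ × ℂ) :
    autHol α c w = (w.1 * holFactor α c w.2, moebius c w.2) := rfl

theorem aut_eq (α : ℝ) (a : ℂ) (w : ℂ × ℂ) :
    aut α a w = (moebius a w.1, w.2 * autFactor α a w.1) := by
  rw [aut, autFactor, mul_assoc]

theorem measurable_holFactor (α : ℝ) (c : ℂ) : Measurable (holFactor α c) := by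
  unfold holFactor
  fun_prop

theorem measurable_autFactor (α : ℝ) (a : ℂ) : Measurable (autFactor α a) := by
  have := measurable_moebius a
  unfold autFactor
  fun_prop

theorem measurable_autHol (α : ℝ) (c : ℂ) : Measurable (autHol α c) := by
  have := measurable_moebius c
  have := measurable_holFactor α c
  simp only [funext (autHol_eq α c)]
  fun_prop

theorem measurable_aut (α : ℝ) (a : ℂ) : Measurable (aut α a) := by
  have := measurable_moebius a
  have := measurable_autFactor α a
  simp only [funext (aut_eq α a)]
  fun_prop

theorem one_sub_conj_mul_re_pos {a w : ℂ} (ha : ‖a‖ < 1) (hw : ‖w‖ < 1) :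
    0 < (1 - conj a * w).re := by
  have h : ‖conj a * w‖ < 1 := by
    rw [norm_mul, RCLike.norm_conj]
    nlinarith [norm_nonneg a, norm_nonneg w]
  have := Complex.re_le_norm (conj a * w)
  rw [Complex.sub_re, Complex.one_re]
  linarith

theorem arg_ne_pi_of_re_pos {z : ℂ} (hz : 0 < z.re) : z.arg ≠ Real.pi := fun h =>
  absurd (Complex.arg_eq_pi_iff.1 h).1 hz.le.not_gt

theorem holBase_re_pos {c y : ℂ} (hc : ‖c‖ < 1) (hy : ‖y‖ < 1) :
    0 < (((√(1 - ‖c‖ ^ 2) : ℝ) : ℂ) / (1 - conj c * y)).re := by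
  rw [div_eq_mul_inv, Complex.re_ofReal_mul, Complex.inv_re]
  have h1 := one_sub_conj_mul_re_pos hc hy
  have h2 := Complex.normSq_pos.2 (one_sub_conj_mul_ne_zero hc hy)
  have h3 := Real.sqrt_pos.2 (one_sub_sq_norm_pos hc)
  positivity

theorem norm_holFactor {c y : ℂ} (α : ℝ) (hc : ‖c‖ < 1) :
    ‖holFactor α c y‖ = moebiusJac c y ^ (α / 2) := by
  have h := one_sub_sq_norm_pos hc
  rw [holFactor, Complex.norm_cpow_real, norm_div, Complex.norm_real, Real.norm_eq_abs,
    abs_of_nonneg (Real.sqrt_nonneg _), moebiusJac]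
  have h1 : √(1 - ‖c‖ ^ 2) / ‖1 - conj c * y‖ =
      ((1 - ‖c‖ ^ 2) / ‖1 - conj c * y‖ ^ 2) ^ (1 / 2 : ℝ) := by
    rw [← Real.sqrt_eq_rpow, Real.sqrt_div h.le, Real.sqrt_sq (norm_nonneg _)]
  rw [h1, ← Real.rpow_mul (by positivity)]
  congr 1
  ring

theorem holFactor_ne_zero {c y : ℂ} (α : ℝ) (hc : ‖c‖ < 1) (hy : ‖y‖ < 1) :
    holFactor α c y ≠ 0 := by
  rw [← norm_pos_iff, norm_holFactor α hc]
  exact Real.rpow_pos_of_pos (moebiusJac_pos hc hy) _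

/-- The bases of the two powers are mutually inverse. They have positive real part, so the principal
power respects inversion. -/
theorem holFactor_mul_moebius {c y : ℂ} (α : ℝ) (hc : ‖c‖ < 1) (hy : ‖y‖ < 1) :
    holFactor α c y * holFactor α c (moebius c y) = 1 := by
  have h1 := one_sub_conj_mul_ne_zero hc hy
  have h2 := one_sub_conj_mul_ne_zero hc (norm_moebius_lt_one hc hy)
  have h3 : ((√(1 - ‖c‖ ^ 2) : ℝ) : ℂ) * ((√(1 - ‖c‖ ^ 2) : ℝ) : ℂ) =
      (1 - conj c * y) * (1 - conj c * moebius c y) := by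
    rw [one_sub_conj_mul_moebius hc hy, ← Complex.ofReal_mul,
      Real.mul_self_sqrt (one_sub_sq_norm_pos hc).le]
  have h4 : ((√(1 - ‖c‖ ^ 2) : ℝ) : ℂ) / (1 - conj c * moebius c y) =
      (((√(1 - ‖c‖ ^ 2) : ℝ) : ℂ) / (1 - conj c * y))⁻¹ := by
    apply eq_inv_of_mul_eq_one_left
    rw [div_mul_div_comm, h3, mul_comm (1 - conj c * y), div_self (mul_ne_zero h2 h1)]
  have h5 := holFactor_ne_zero α hc hy
  rw [holFactor] at h5
  rw [holFactor, holFactor, h4, Complex.inv_cpow _ _ (arg_ne_pi_of_re_pos (holBase_re_pos hc hy)),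
    mul_inv_cancel₀ h5]

theorem autHol_autHol {c : ℂ} (α : ℝ) (hc : ‖c‖ < 1) {w : ℂ × ℂ} (hw : ‖w.2‖ < 1) :
    autHol α c (autHol α c w) = w := by
  rw [autHol_eq, autHol_eq]
  ext
  · simp only [mul_assoc, holFactor_mul_moebius α hc hw, mul_one]
  · exact moebius_moebius hc hw

theorem one_sub_rpow_pos {α x : ℝ} (hα : 0 < α) (h0 : 0 ≤ x) (h1 : x < 1) :
    0 < 1 - x ^ (2 / α) :=
  sub_pos.2 (Real.rpow_lt_one h0 h1 (by positivity))

/-- The fibre of the domain over `x` is a disc of squared radius `1 - |x|^(2/α)`. The square root in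
`aut` is the correction that makes the factor scale the fibre over `x` exactly onto the fibre over
`moebius a x`. -/
theorem norm_autFactor_sq {α : ℝ} (hα : 0 < α) {a x : ℂ} (ha : ‖a‖ < 1) (hx : ‖x‖ < 1) :
    ‖autFactor α a x‖ ^ 2 = (1 - ‖moebius a x‖ ^ (2 / α)) / (1 - ‖x‖ ^ (2 / α)) := by
  have hm := norm_moebius_lt_one ha hx
  have h1 := one_sub_rpow_pos hα (norm_nonneg _) hx
  have h2 := one_sub_rpow_pos hα (norm_nonneg _) hm
  have h3 := one_sub_sq_norm_pos hx
  have h4 := one_sub_sq_norm_pos hm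
  have h5 := one_sub_sq_norm_pos ha
  have h6 := norm_one_sub_conj_mul_pos ha hx
  rw [autFactor, norm_mul, norm_div, Complex.norm_real, Complex.norm_real, Real.norm_eq_abs,
    Real.norm_eq_abs, abs_of_nonneg (Real.sqrt_nonneg _), abs_of_nonneg (Real.sqrt_nonneg _),
    mul_pow, div_pow, Real.sq_sqrt h5.le, Real.sq_sqrt (by positivity)]
  rw [mul_comm (1 - ‖x‖ ^ (2 / α)), mul_div_mul_comm, one_sub_sq_norm_moebius ha hx]
  field_simp

theorem autFactor_ne_zero {α : ℝ} (hα : 0 < α) {a x : ℂ} (ha : ‖a‖ < 1) (hx : ‖x‖ < 1) :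
    autFactor α a x ≠ 0 := by
  have hm := norm_moebius_lt_one ha hx
  have h := norm_autFactor_sq hα ha hx
  intro h0
  rw [h0, norm_zero] at h
  have := div_pos (one_sub_rpow_pos hα (norm_nonneg _) hm) (one_sub_rpow_pos hα (norm_nonneg _) hx)
  linarith

theorem autFactor_mul_moebius {α : ℝ} (hα : 0 < α) {a x : ℂ} (ha : ‖a‖ < 1) (hx : ‖x‖ < 1) :
    autFactor α a x * autFactor α a (moebius a x) = 1 := by
  have hm := norm_moebius_lt_one ha hx
  have h1 := one_sub_rpow_pos hα (norm_nonneg _) hx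
  have h2 := one_sub_rpow_pos hα (norm_nonneg _) hm
  have h3 := one_sub_sq_norm_pos hx
  have h4 := one_sub_sq_norm_pos hm
  have h6 := one_sub_conj_mul_ne_zero ha hx
  have h7 := one_sub_conj_mul_ne_zero ha hm
  have h8 : ((√(1 - ‖a‖ ^ 2) : ℝ) : ℂ) * ((√(1 - ‖a‖ ^ 2) : ℝ) : ℂ) =
      (1 - conj a * x) * (1 - conj a * moebius a x) := by
    rw [one_sub_conj_mul_moebius ha hx, ← Complex.ofReal_mul,
      Real.mul_self_sqrt (one_sub_sq_norm_pos ha).le]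
  rw [autFactor, autFactor, mul_mul_mul_comm, div_mul_div_comm, h8,
    div_self (mul_ne_zero h6 h7), one_mul, moebius_moebius ha hx, ← Complex.ofReal_mul,
    ← Real.sqrt_mul (by positivity), Complex.ofReal_eq_one, Real.sqrt_eq_one]
  field_simp

theorem aut_aut {α : ℝ} (hα : 0 < α) {a : ℂ} (ha : ‖a‖ < 1) {w : ℂ × ℂ} (hw : ‖w.1‖ < 1) :
    aut α a (aut α a w) = w := by
  rw [aut_eq, aut_eq]
  ext
  · exact moebius_moebius ha hw
  · simp only [mul_assoc, autFactor_mul_moebius hα ha hw, mul_one]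

theorem mem_domain {α : ℝ} {hα : 0 < α} {z : ℂ × ℂ} :
    z ∈ domain α hα ↔ ‖z.1‖ ^ (2 / α) + ‖z.2‖ ^ 2 < 1 := Iff.rfl

theorem norm_fst_lt_one {α : ℝ} {hα : 0 < α} {z : ℂ × ℂ} (hz : z ∈ domain α hα) : ‖z.1‖ < 1 := by
  rw [mem_domain] at hz
  by_contra! h
  have := Real.one_le_rpow h (show 0 ≤ 2 / α by positivity)
  nlinarith [norm_nonneg z.2]

theorem norm_snd_lt_one {α : ℝ} {hα : 0 < α} {z : ℂ × ℂ} (hz : z ∈ domain α hα) : ‖z.2‖ < 1 := by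
  rw [mem_domain] at hz
  have := Real.rpow_nonneg (norm_nonneg z.1) (2 / α)
  nlinarith [norm_nonneg z.2]

/-- Both `|w₁|^(2/α)` and `1 - |w₂|²` get multiplied by `moebiusJac c w.2`, so the defining
inequality is preserved. -/
theorem autHol_mem_domain {α : ℝ} {hα : 0 < α} {c : ℂ} (hc : ‖c‖ < 1) {w : ℂ × ℂ}
    (hw : w ∈ domain α hα) : autHol α c w ∈ domain α hα := by
  have hw2 := norm_snd_lt_one hw
  have hJ := moebiusJac_pos hc hw2
  have h2 : (moebiusJac c w.2 ^ (α / 2)) ^ (2 / α) = moebiusJac c w.2 := by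
    rw [← Real.rpow_mul hJ.le]
    field_simp
    exact Real.rpow_one _
  have h3 : 1 - ‖moebius c w.2‖ ^ 2 = moebiusJac c w.2 * (1 - ‖w.2‖ ^ 2) := by
    rw [one_sub_sq_norm_moebius hc hw2, moebiusJac]
    ring
  rw [mem_domain] at hw ⊢
  rw [autHol_eq]
  simp only [norm_mul]
  rw [Real.mul_rpow (norm_nonneg _) (norm_nonneg _), norm_holFactor α hc, h2]
  nlinarith

theorem aut_mem_domain {α : ℝ} {hα : 0 < α} {a : ℂ} (ha : ‖a‖ < 1) {w : ℂ × ℂ}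
    (hw : w ∈ domain α hα) : aut α a w ∈ domain α hα := by
  have hw1 := norm_fst_lt_one hw
  have h1 := one_sub_rpow_pos hα (norm_nonneg _) hw1
  have h2 := one_sub_rpow_pos hα (norm_nonneg _) (norm_moebius_lt_one ha hw1)
  rw [mem_domain] at hw ⊢
  rw [aut_eq]
  simp only [norm_mul, mul_pow, norm_autFactor_sq hα ha hw1]
  have h3 : ‖w.2‖ ^ 2 * ((1 - ‖moebius a w.1‖ ^ (2 / α)) / (1 - ‖w.1‖ ^ (2 / α))) <
      1 - ‖moebius a w.1‖ ^ (2 / α) := by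
    rw [mul_div_assoc', div_lt_iff₀ h1, mul_comm]
    exact mul_lt_mul_of_pos_left (by linarith) h2
  linarith

theorem norm_fα_lt_one {α : ℝ} {hα : 0 < α} {z : ℂ × ℂ} (hz : z ∈ domain α hα) :
    ‖fα α z‖ < 1 := by
  have h2 := one_sub_sq_norm_pos (norm_snd_lt_one hz)
  have h3 : 0 < (1 - ‖z.2‖ ^ 2) ^ (α / 2) := Real.rpow_pos_of_pos h2 _
  rw [mem_domain] at hz
  rw [fα, norm_div, Complex.norm_real, Real.norm_of_nonneg h3.le, div_lt_one h3]
  have h4 : ‖z.1‖ = (‖z.1‖ ^ (2 / α)) ^ (α / 2) := by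
    rw [← Real.rpow_mul (norm_nonneg _)]
    field_simp
    exact (Real.rpow_one _).symm
  rw [h4]
  exact Real.rpow_lt_rpow (by positivity) (by linarith) (by positivity)

/-! ### Jacobians and null sets. -/

theorem lintegral_comp_autHol {α : ℝ} {c : ℂ} (hc : ‖c‖ < 1) {g : ℂ × ℂ → ENNReal}
    (hg : Measurable g) :
    ∫⁻ w in univ ×ˢ ball (0 : ℂ) 1,
      ENNReal.ofReal (moebiusJac c w.2 ^ (α + 2)) * g (autHol α c w) =
      ∫⁻ w in univ ×ˢ ball (0 : ℂ) 1, g w := by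
  rw [← lintegral_comp_fibre_swap hc (measurable_holFactor α c)
    (fun w hw => holFactor_ne_zero α hc hw) hg]
  refine setLIntegral_congr_fun (MeasurableSet.univ.prod measurableSet_ball) fun w hw => ?_
  -- The exponent `α + 2` collects `2` from the base and `α` from the squared modulus of the fibre
  -- factor.
  have hJ := moebiusJac_pos hc (mem_ball_zero_iff.1 hw.2)
  rw [autHol_eq, norm_holFactor α hc, mul_pow, ← Real.rpow_natCast (_ ^ (α / 2)),
    ← Real.rpow_mul hJ.le, Real.rpow_add hJ, mul_comm (_ ^ α)]
  norm_num

theorem lintegral_comp_aut {α : ℝ} (hα : 0 < α) {a : ℂ} (ha : ‖a‖ < 1) {g : ℂ × ℂ → ENNReal}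
    (hg : Measurable g) :
    ∫⁻ w in ball (0 : ℂ) 1 ×ˢ univ, ENNReal.ofReal (moebiusJac a w.1 ^ 2 *
      ((1 - ‖moebius a w.1‖ ^ (2 / α)) / (1 - ‖w.1‖ ^ (2 / α)))) * g (aut α a w) =
      ∫⁻ w in ball (0 : ℂ) 1 ×ˢ univ, g w := by
  rw [← lintegral_comp_fibre ha (measurable_autFactor α a)
    (fun w hw => autFactor_ne_zero hα ha hw) hg]
  refine setLIntegral_congr_fun (measurableSet_ball.prod MeasurableSet.univ) fun w hw => ?_
  rw [aut_eq, ← norm_autFactor_sq hα ha (mem_ball_zero_iff.1 hw.1), mul_pow]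

/-- Apply the change of variables to the indicator of a null set: the integral vanishes, and
positivity of the Jacobian forces the preimage to be null. -/
theorem quasiMeasurePreserving_of_lintegral {U S : Set (ℂ × ℂ)} (hU : MeasurableSet U)
    (hS : MeasurableSet S) (hUS : U ⊆ S) {T : ℂ × ℂ → ℂ × ℂ} (hT : Measurable T)
    (hTU : ∀ w ∈ U, T w ∈ U) {J : ℂ × ℂ → ℝ} (hJ : Measurable J) (hJ0 : ∀ w ∈ U, 0 < J w)
    (h : ∀ g : ℂ × ℂ → ENNReal, Measurable g →
      ∫⁻ w in S, ENNReal.ofReal (J w) * g (T w) = ∫⁻ w in S, g w) :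
    Measure.QuasiMeasurePreserving T (volume.restrict U) (volume.restrict U) := by
  refine ⟨hT, Measure.AbsolutelyContinuous.mk fun s hs h0 => ?_⟩
  rw [Measure.restrict_apply hs] at h0
  rw [Measure.map_apply hT hs, Measure.restrict_apply (hT hs)]
  have hg : Measurable ((s ∩ U).indicator (1 : ℂ × ℂ → ENNReal)) :=
    measurable_one.indicator (hs.inter hU)
  have h := h _ hg
  have hm : Measurable fun w : ℂ × ℂ => ENNReal.ofReal (J w) *
      (s ∩ U).indicator (1 : ℂ × ℂ → ENNReal) (T w) := by
    fun_prop
  have h1 : ∫⁻ w in S, (s ∩ U).indicator (1 : ℂ × ℂ → ENNReal) w = 0 := by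
    refine le_antisymm ((setLIntegral_le_lintegral _ _).trans ?_) bot_le
    rw [lintegral_indicator_one (hs.inter hU), h0]
  rw [h1, lintegral_eq_zero_iff hm, Filter.EventuallyEq, ae_restrict_iff' hS, ae_iff] at h
  refine measure_mono_null (fun w hw => ?_) h
  have : T w ∈ s ∩ U := ⟨hw.1, hTU w hw.2⟩
  simp [hUS hw.2, this.1, this.2, hJ0 w hw.2]

theorem quasiMeasurePreserving_autHol {α : ℝ} (hα : 0 < α) {c : ℂ} (hc : ‖c‖ < 1) :
    Measure.QuasiMeasurePreserving (autHol α c) (Bergman.vol (domain α hα))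
      (Bergman.vol (domain α hα)) := by
  refine quasiMeasurePreserving_of_lintegral (domain α hα).isOpen.measurableSet
    (MeasurableSet.univ.prod measurableSet_ball)
    (fun w hw => ⟨mem_univ _, mem_ball_zero_iff.2 (norm_snd_lt_one hw)⟩)
    (measurable_autHol α c) (fun w hw => autHol_mem_domain hc hw) ?_
    (fun w hw => Real.rpow_pos_of_pos (moebiusJac_pos hc (norm_snd_lt_one hw)) _)
    (fun g hg => lintegral_comp_autHol hc hg)
  unfold moebiusJac
  fun_prop

theorem quasiMeasurePreserving_aut {α : ℝ} (hα : 0 < α) {a : ℂ} (ha : ‖a‖ < 1) :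
    Measure.QuasiMeasurePreserving (aut α a) (Bergman.vol (domain α hα))
      (Bergman.vol (domain α hα)) := by
  refine quasiMeasurePreserving_of_lintegral (domain α hα).isOpen.measurableSet
    (measurableSet_ball.prod MeasurableSet.univ)
    (fun w hw => ⟨mem_ball_zero_iff.2 (norm_fst_lt_one hw), mem_univ _⟩)
    (measurable_aut α a) (fun w hw => aut_mem_domain ha hw) ?_
    (fun w hw => ?_)
    (fun g hg => lintegral_comp_aut hα ha hg)
  · have := measurable_moebius a
    unfold moebiusJac
    fun_prop
  · have h := norm_fst_lt_one hw
    exact mul_pos (pow_pos (moebiusJac_pos ha h) 2)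
      (div_pos (one_sub_rpow_pos hα (norm_nonneg _) (norm_moebius_lt_one ha h))
        (one_sub_rpow_pos hα (norm_nonneg _) h))

theorem quasiMeasurePreserving_translation {α : ℝ} (hα : 0 < α) {z : ℂ × ℂ}
    (hz : z ∈ domain α hα) :
    Measure.QuasiMeasurePreserving (translation α z) (Bergman.vol (domain α hα))
      (Bergman.vol (domain α hα)) :=
  (quasiMeasurePreserving_autHol hα (norm_snd_lt_one hz)).comp
    (quasiMeasurePreserving_aut hα (norm_fα_lt_one hz))

theorem volume_domain_lt_top {α : ℝ} (hα : 0 < α) :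
    volume (domain α hα : Set (ℂ × ℂ)) < ⊤ := by
  refine (measure_mono fun w hw => ?_).trans_lt (measure_ball_lt_top (x := (0 : ℂ × ℂ)) (r := 1))
  rw [mem_ball_zero_iff, Prod.norm_def]
  exact max_lt (norm_fst_lt_one hw) (norm_snd_lt_one hw)

/-! ### Adapted regions and their symmetry. -/

theorem min_mul_le_one_sub_rpow {β x : ℝ} (hβ : 0 < β) (h0 : 0 ≤ x) (h1 : x ≤ 1) :
    min 1 β * (1 - x) ≤ 1 - x ^ β := by
  rcases le_total 1 β with h | h
  · rw [min_eq_left h]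
    have := Real.rpow_le_rpow_of_exponent_ge' h0 h1 zero_le_one h
    rw [Real.rpow_one] at this
    linarith
  · rw [min_eq_right h]
    have := rpow_one_add_le_one_add_mul_self (s := x - 1) (by linarith) hβ.le h
    rw [add_sub_cancel] at this
    linarith

/-- With the preceding bound, `1 - x^β` and `1 - x` are comparable on `[0, 1]`. In each, one range
of `β` is monotonicity of powers in the exponent and the other is Bernoulli's inequality. -/
theorem one_sub_rpow_le_max_mul {β x : ℝ} (hβ : 0 < β) (h0 : 0 ≤ x) (h1 : x ≤ 1) :
    1 - x ^ β ≤ max 1 β * (1 - x) := by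
  rcases le_total 1 β with h | h
  · rw [max_eq_right h]
    have := one_add_mul_self_le_rpow_one_add (s := x - 1) (by linarith) h
    rw [add_sub_cancel] at this
    linarith
  · rw [max_eq_left h]
    have := Real.rpow_le_rpow_of_exponent_ge' h0 h1 hβ.le h
    rw [Real.rpow_one] at this
    linarith

/-- The pullback of `w` by `autHol α z.2` lies in a polydisc about `(fα α z, 0)` whose radii are
`r (1 - |fα α z|)` and `√(s (1 - |fα α z|))`. -/
def Near (α r s : ℝ) (z w : ℂ × ℂ) : Prop :=
  ‖(autHol α z.2 w).1 - fα α z‖ < r * (1 - ‖fα α z‖) ∧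
    ‖moebius z.2 w.2‖ ^ 2 < s * (1 - ‖fα α z‖)

/-- A quantity comparable to the volume of `{w | Near α r s z w}`. -/
noncomputable def nearVol (α : ℝ) (z : ℂ × ℂ) : ℝ :=
  (1 - ‖z.2‖ ^ 2) ^ (α + 2) * (1 - ‖fα α z‖) ^ 3

/-- The ratio of the radii used in the mean value estimate. -/
noncomputable def smallRadius (α : ℝ) : ℝ := min 1 (2 / α) / 16

theorem smallRadius_pos {α : ℝ} (hα : 0 < α) : 0 < smallRadius α := by
  unfold smallRadius
  positivity

theorem smallRadius_le (α : ℝ) : smallRadius α ≤ 1 / 16 := by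
  unfold smallRadius
  linarith [min_le_left 1 (2 / α)]

/-- The choice of `smallRadius` is made for this: the factor `(1 - |moebius z.2 w.2|²)^(α/2)` then
differs from `1` by at most `(1 - |fα α z|)/16` on the regions used. -/
theorem max_mul_smallRadius {α : ℝ} (hα : 0 < α) : max 1 (α / 2) * smallRadius α = 1 / 16 := by
  unfold smallRadius
  rcases le_total 2 α with h | h
  · rw [max_eq_right (by linarith), min_eq_right (by rw [div_le_one hα]; exact h)]
    field_simp
  · rw [max_eq_left (by linarith), min_eq_left (by rw [one_le_div hα]; exact h)]
    norm_num

theorem nearVol_pos {α : ℝ} {hα : 0 < α} {z : ℂ × ℂ} (hz : z ∈ domain α hα) :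
    0 < nearVol α z :=
  mul_pos (Real.rpow_pos_of_pos (one_sub_sq_norm_pos (norm_snd_lt_one hz)) _)
    (pow_pos (sub_pos.2 (norm_fα_lt_one hz)) 3)

theorem fst_eq_fα_mul {α : ℝ} {hα : 0 < α} {z : ℂ × ℂ} (hz : z ∈ domain α hα) :
    z.1 = fα α z * ((1 - ‖z.2‖ ^ 2) ^ (α / 2) : ℝ) := by
  have h := Real.rpow_pos_of_pos (one_sub_sq_norm_pos (norm_snd_lt_one hz)) (α / 2)
  rw [fα, div_mul_cancel₀]
  exact_mod_cast h.ne'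

theorem holFactor_eq {α : ℝ} {c y : ℂ} (hc : ‖c‖ < 1) :
    holFactor α c y = ((1 - ‖c‖ ^ 2) ^ (α / 2) : ℝ) * ((1 - conj c * y)⁻¹) ^ (α : ℂ) := by
  have h := one_sub_sq_norm_pos hc
  have hr := Real.sqrt_pos.2 h
  have hr0 : ((√(1 - ‖c‖ ^ 2) : ℝ) : ℂ) ≠ 0 := by exact_mod_cast hr.ne'
  rw [holFactor, div_eq_mul_inv]
  -- No bound on `y` is assumed, so the base may degenerate to `0`, where the power depends on
  -- whether `α = 0`.
  by_cases hx : (1 - conj c * y)⁻¹ = 0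
  · rcases eq_or_ne α 0 with rfl | hα
    · simp
    · simp [hx, Complex.zero_cpow, hα]
  · rw [Complex.cpow_def_of_ne_zero (mul_ne_zero hr0 hx), Complex.log_ofReal_mul hr hx, add_mul,
      Complex.exp_add, ← Complex.cpow_def_of_ne_zero hx, Real.sqrt_eq_rpow, Real.log_rpow h,
      Real.rpow_def_of_pos h]
    push_cast
    ring_nf

/-- `autHol α z.2 w` and `autHol α w.2 z` have first components that are conjugate
multiples of `fα α w` and `fα α z`. -/
theorem exists_autHol_fst {α : ℝ} {hα : 0 < α} {z w : ℂ × ℂ} (hz : z ∈ domain α hα)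
    (hw : w ∈ domain α hα) : ∃ e : ℂ, ‖e‖ = 1 ∧
      (autHol α z.2 w).1 = fα α w * (((1 - ‖moebius z.2 w.2‖ ^ 2) ^ (α / 2) : ℝ) * e) ∧
      (autHol α w.2 z).1 = fα α z * (((1 - ‖moebius z.2 w.2‖ ^ 2) ^ (α / 2) : ℝ) * conj e) := by
  have hz2 := norm_snd_lt_one hz
  have hw2 := norm_snd_lt_one hw
  set q : ℂ := 1 - conj z.2 * w.2 with hq
  have hq' : 1 - conj w.2 * z.2 = conj q := by simp [hq, mul_comm]
  have hq0 : q ≠ 0 := one_sub_conj_mul_ne_zero hz2 hw2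
  have hqarg : q⁻¹.arg ≠ Real.pi := by
    apply arg_ne_pi_of_re_pos
    rw [Complex.inv_re]
    exact div_pos (one_sub_conj_mul_re_pos hz2 hw2) (Complex.normSq_pos.2 hq0)
  -- Exchanging `z` and `w` conjugates `q`. The principal power commutes with conjugation off the
  -- negative axis, so only the phase `Q / |Q|` changes, to its conjugate.
  have hQ : (conj q)⁻¹ ^ (α : ℂ) = conj (q⁻¹ ^ (α : ℂ)) := by
    rw [← map_inv₀, Complex.conj_cpow _ _ hqarg, Complex.conj_ofReal]
  set Q : ℂ := q⁻¹ ^ (α : ℂ) with hQdef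
  have hQn : ‖Q‖ = ‖q‖⁻¹ ^ α := by rw [hQdef, Complex.norm_cpow_real, norm_inv]
  have hQ0 : 0 < ‖Q‖ := by
    rw [hQn]
    exact Real.rpow_pos_of_pos (inv_pos.2 (norm_pos_iff.2 hq0)) _
  have htz := one_sub_sq_norm_pos hz2
  have htw := one_sub_sq_norm_pos hw2
  have hlam : (1 - ‖moebius z.2 w.2‖ ^ 2) ^ (α / 2) =
      (1 - ‖z.2‖ ^ 2) ^ (α / 2) * (1 - ‖w.2‖ ^ 2) ^ (α / 2) * ‖Q‖ := by
    rw [one_sub_sq_norm_moebius hz2 hw2, ← hq, div_eq_mul_inv,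
      Real.mul_rpow (by positivity) (by positivity), Real.mul_rpow htz.le htw.le, hQn]
    congr 1
    rw [← inv_pow, ← Real.rpow_natCast, ← Real.rpow_mul (by positivity)]
    congr 1
    push_cast
    ring
  refine ⟨Q / ‖Q‖, ?_, ?_, ?_⟩
  · rw [norm_div, Complex.norm_real, norm_norm, div_self hQ0.ne']
  · have hQ1 : (‖Q‖ : ℂ) ≠ 0 := by exact_mod_cast hQ0.ne'
    rw [autHol_eq, holFactor_eq hz2, ← hq, ← hQdef, hlam]
    dsimp only
    conv_lhs => rw [fst_eq_fα_mul hw]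
    push_cast
    field_simp
  · have hQ1 : (‖Q‖ : ℂ) ≠ 0 := by exact_mod_cast hQ0.ne'
    rw [autHol_eq, holFactor_eq hw2, hq', hQ, hlam, map_div₀, Complex.conj_ofReal]
    dsimp only
    conv_lhs => rw [fst_eq_fα_mul hz]
    push_cast
    field_simp

/-- Up to a unimodular factor, the first coordinates of the two pullbacks are `fα α w` and `fα α z`
times one real number close to `1`. So closeness in one chart gives closeness in the other, with
slightly worse constants. -/
theorem Near.symm {α : ℝ} {hα : 0 < α} {z w : ℂ × ℂ} (hz : z ∈ domain α hα)
    (hw : w ∈ domain α hα) (h : Near α (1 / 8) (smallRadius α) z w) :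
    Near α (1 / 2) (2 * smallRadius α) w z ∧ nearVol α w ≤ 4 ^ (α + 2) * 8 * nearVol α z := by
  obtain ⟨e, he, h1, h2⟩ := exists_autHol_fst hz hw
  obtain ⟨h3, h4⟩ := h
  rw [h1] at h3
  have hz2 := norm_snd_lt_one hz
  have hw2 := norm_snd_lt_one hw
  have ha := norm_fα_lt_one hz
  have hg := norm_fα_lt_one hw
  have hs := smallRadius_pos hα
  have hm := norm_moebius_lt_one hz2 hw2
  have hρ := one_sub_sq_norm_pos hm
  have hlam := one_sub_rpow_le_max_mul (β := α / 2) (by positivity) hρ.le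
    (by nlinarith [norm_nonneg (moebius z.2 w.2)])
  have hlam1 : (1 - ‖moebius z.2 w.2‖ ^ 2) ^ (α / 2) ≤ 1 :=
    Real.rpow_le_one hρ.le (by nlinarith [norm_nonneg (moebius z.2 w.2)]) (by positivity)
  set lam := (1 - ‖moebius z.2 w.2‖ ^ 2) ^ (α / 2) with hlamdef
  have hlam2 : 1 - lam ≤ 1 / 16 * (1 - ‖fα α z‖) := by
    rw [← max_mul_smallRadius hα]
    have : 0 < max 1 (α / 2) := by positivity
    nlinarith
  set a := fα α z with hadef
  set g := fα α w with hgdef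
  have hee : e * conj e = 1 := by rw [Complex.mul_conj']; simp [he]
  have hge : ‖g * e‖ = ‖g‖ := by rw [norm_mul, he, mul_one]
  have hn1 : ‖((1 - lam : ℝ) : ℂ)‖ ≤ 1 / 16 * (1 - ‖a‖) := by
    rw [Complex.norm_real, Real.norm_of_nonneg (by linarith)]
    exact hlam2
  -- `3/16 = 1/8 + 1/16`: the radius in the hypothesis plus the error from replacing `lam` by `1`.
  -- The next bound adds another `1/16`.
  have hn2 : ‖g * e - a‖ ≤ 3 / 16 * (1 - ‖a‖) := by
    have : g * e - a = (g * (lam * e) - a) + ((1 - lam : ℝ) : ℂ) * (g * e) := by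
      push_cast
      ring
    rw [this]
    refine (norm_add_le _ _).trans ?_
    rw [norm_mul, hge]
    nlinarith [norm_nonneg g, norm_nonneg ((1 - lam : ℝ) : ℂ)]
  have hn3 : ‖a * (lam * conj e) - g‖ ≤ 4 / 16 * (1 - ‖a‖) := by
    have : a * (lam * conj e) - g =
        ((a - g * e) - ((1 - lam : ℝ) : ℂ) * a) * conj e := by
      push_cast
      linear_combination g * hee
    rw [this, norm_mul, RCLike.norm_conj, he, mul_one]
    refine (norm_sub_le _ _).trans ?_
    rw [norm_mul, norm_sub_rev]
    nlinarith [norm_nonneg a, norm_nonneg ((1 - lam : ℝ) : ℂ)]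
  have hn4 : ‖g‖ ≤ ‖a‖ + 3 / 16 * (1 - ‖a‖) := by
    have := norm_le_norm_add_norm_sub' (g * e) a
    rw [hge] at this
    linarith
  have hn5 : ‖a‖ ≤ ‖g‖ + 3 / 16 * (1 - ‖a‖) := by
    have := norm_le_norm_add_norm_sub' a (g * e)
    rw [hge, norm_sub_rev] at this
    linarith
  refine ⟨⟨?_, ?_⟩, ?_⟩
  · rw [h2]
    linarith
  · rw [norm_moebius_comm]
    have : (1 - ‖a‖) ≤ 2 * (1 - ‖g‖) := by linarith
    calc _ < smallRadius α * (1 - ‖a‖) := h4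
      _ ≤ smallRadius α * (2 * (1 - ‖g‖)) := by gcongr
      _ = _ := by ring
  · have h5 : ‖moebius z.2 w.2‖ ^ 2 ≤ 1 / 16 := by
      have := smallRadius_le α
      nlinarith [norm_nonneg a]
    have h6 : ‖moebius z.2 w.2‖ ≤ 1 / 4 := by nlinarith [norm_nonneg (moebius z.2 w.2)]
    -- Write `w.2` as the `moebius z.2` image of a point of modulus at most `1/4`. This factor `4`,
    -- and `1 - |g| ≤ 2(1 - |a|)` cubed, give the constant `4^(α+2) * 8`.
    have h7 : 1 - ‖w.2‖ ^ 2 ≤ 4 * (1 - ‖z.2‖ ^ 2) := by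
      have h8 := one_sub_sq_norm_moebius hz2 hm
      rw [moebius_moebius hz2 hw2] at h8
      have h9 : 1 / 2 ≤ ‖1 - conj z.2 * moebius z.2 w.2‖ := by
        have := norm_sub_norm_le (1 : ℂ) (conj z.2 * moebius z.2 w.2)
        rw [norm_mul, RCLike.norm_conj, norm_one] at this
        nlinarith [norm_nonneg (moebius z.2 w.2), norm_nonneg z.2]
      rw [h8, div_le_iff₀ (by positivity)]
      have h10 := one_sub_sq_norm_pos hz2
      have h11 : 1 / 4 ≤ ‖1 - conj z.2 * moebius z.2 w.2‖ ^ 2 := by nlinarith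
      nlinarith [sq_nonneg ‖moebius z.2 w.2‖]
    have htz := one_sub_sq_norm_pos hz2
    have htw := one_sub_sq_norm_pos hw2
    have hg0 : 0 ≤ 1 - ‖g‖ := by linarith
    calc nearVol α w ≤ (4 * (1 - ‖z.2‖ ^ 2)) ^ (α + 2) * (2 * (1 - ‖a‖)) ^ 3 := by
          unfold nearVol
          gcongr
          rw [← hgdef]
          linarith
      _ = _ := by
          rw [Real.mul_rpow (by norm_num) htz.le, nearVol, ← hadef]
          ring

theorem measurableSet_near_prod (α r s : ℝ) :
    MeasurableSet {p : (ℂ × ℂ) × (ℂ × ℂ) | Near α r s p.1 p.2} := by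
  have hc : Measurable fun x : ℂ => conj x := Complex.continuous_conj.measurable
  have h1 : Measurable fun p : (ℂ × ℂ) × (ℂ × ℂ) => (autHol α p.1.2 p.2).1 := by
    unfold autHol
    fun_prop
  have h2 : Measurable fun p : (ℂ × ℂ) × (ℂ × ℂ) => fα α p.1 := by
    unfold fα
    fun_prop
  have h3 : Measurable fun p : (ℂ × ℂ) × (ℂ × ℂ) => moebius p.1.2 p.2.2 := by
    unfold moebius
    fun_prop
  exact (measurableSet_lt (h1.sub h2).norm ((h2.norm.const_sub 1).const_mul r)).inter
    (measurableSet_lt (h3.norm.pow_const 2) ((h2.norm.const_sub 1).const_mul s))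

theorem measurableSet_near (α r s : ℝ) (z : ℂ × ℂ) : MeasurableSet {w | Near α r s z w} :=
  (measurableSet_near_prod α r s).preimage measurable_prodMk_left

/-! ### The mean value estimate. -/

theorem eLpNorm_two_sq {X : Type*} [MeasurableSpace X] (f : X → ℂ) (μ : Measure X) :
    eLpNorm f 2 μ ^ 2 = ∫⁻ x, ‖f x‖ₑ ^ 2 ∂μ := by
  have h := eLpNorm_nnreal_pow_eq_lintegral (f := f) (μ := μ) (p := 2) two_ne_zero
  rw [NNReal.coe_ofNat, ENNReal.coe_ofNat, ENNReal.rpow_ofNat] at h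
  rw [h]
  exact lintegral_congr fun x => ENNReal.rpow_ofNat _ _

theorem lintegral_comp_affine {H : ℂ × ℂ → ENNReal} (hH : Measurable H) (a : ℂ) {k₁ k₂ : ℂ}
    (h₁ : k₁ ≠ 0) (h₂ : k₂ ≠ 0) :
    ENNReal.ofReal (‖k₁‖ ^ 2 * ‖k₂‖ ^ 2) * ∫⁻ x : ℂ × ℂ, H (a + x.1 * k₁, x.2 * k₂) =
      ∫⁻ y, H y := by
  have e1 : ∫⁻ y, H y = ∫⁻ y₁, ∫⁻ y₂, H (y₁, y₂) := by
    rw [Measure.volume_eq_prod, lintegral_prod _ hH.aemeasurable]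
  have e2 : ∫⁻ x : ℂ × ℂ, H (a + x.1 * k₁, x.2 * k₂) =
      ∫⁻ x₁, ∫⁻ x₂, H (a + x₁ * k₁, x₂ * k₂) := by
    rw [Measure.volume_eq_prod, lintegral_prod _ (by fun_prop)]
  have hm : Measurable fun y₁ => ∫⁻ y₂, H (y₁, y₂) := hH.lintegral_prod_right'
  rw [e1, e2, ← lintegral_add_left_eq_self (fun y₁ => ∫⁻ y₂, H (y₁, y₂)) a,
    ← lintegral_comp_mul_right h₁ fun y => ∫⁻ y₂, H (a + y, y₂),
    lintegral_const_mul (ENNReal.ofReal (‖k₁‖ ^ 2)) (by fun_prop),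
    ENNReal.ofReal_mul (by positivity), mul_assoc]
  congr 1
  rw [← lintegral_const_mul']
  · refine lintegral_congr fun x₁ => ?_
    rw [← lintegral_comp_mul_right h₂ fun y => H (a + x₁ * k₁, y), lintegral_const_mul _
      (by fun_prop)]
  · exact ENNReal.ofReal_ne_top

theorem holFactor_zero {α : ℝ} {c : ℂ} (hc : ‖c‖ < 1) :
    holFactor α c 0 = ((1 - ‖c‖ ^ 2) ^ (α / 2) : ℝ) := by
  rw [holFactor_eq hc]
  simp

theorem autHol_fα_zero {α : ℝ} {hα : 0 < α} {z : ℂ × ℂ} (hz : z ∈ domain α hα) :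
    autHol α z.2 (fα α z, 0) = z := by
  rw [autHol_eq, holFactor_zero (norm_snd_lt_one hz), ← fst_eq_fα_mul hz]
  simp [moebius]

theorem differentiableAt_autHol {α : ℝ} {c : ℂ} (hc : ‖c‖ < 1) {w : ℂ × ℂ} (hw : ‖w.2‖ < 1) :
    DifferentiableAt ℂ (autHol α c) w := by
  have h0 := one_sub_conj_mul_ne_zero hc hw
  unfold autHol
  refine DifferentiableAt.prodMk ?_ ?_
  · refine DifferentiableAt.mul (by fun_prop) (DifferentiableAt.cpow ?_ (by fun_prop) ?_)
    · fun_prop (disch := exact h0)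
    · exact Or.inl (holBase_re_pos hc hw)
  · fun_prop (disch := exact h0)

/-- The squared fibre radius over `y.1` is at least `min 1 (2/α) * (1 - |y.1|)`, where `min 1 (2/α)`
is `16 * smallRadius α` and `1 - |y.1| ≥ 7/8 * (1 - |a|)`. This leaves ample room for `y.2`. -/
theorem polydisc_subset_domain {α : ℝ} (hα : 0 < α) {a : ℂ} (ha : ‖a‖ < 1) {y : ℂ × ℂ}
    (h1 : ‖y.1 - a‖ < 1 / 8 * (1 - ‖a‖)) (h2 : ‖y.2‖ ^ 2 < smallRadius α * (1 - ‖a‖)) :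
    y ∈ domain α hα := by
  have h3 := norm_le_norm_add_norm_sub' y.1 a
  have h4 := min_mul_le_one_sub_rpow (β := 2 / α) (by positivity) (norm_nonneg y.1) (by linarith)
  have h5 : smallRadius α * (1 - ‖a‖) ≤ min 1 (2 / α) * (1 - ‖y.1‖) := by
    have h6 := smallRadius_pos hα
    have h7 : min 1 (2 / α) = 16 * smallRadius α := by unfold smallRadius; ring
    rw [h7]
    nlinarith
  rw [mem_domain]
  linarith

theorem near_autHol_iff {α r s : ℝ} {z y : ℂ × ℂ} (hz : ‖z.2‖ < 1) (hy : ‖y.2‖ < 1) :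
    Near α r s z (autHol α z.2 y) ↔ ‖y.1 - fα α z‖ < r * (1 - ‖fα α z‖) ∧
      ‖y.2‖ ^ 2 < s * (1 - ‖fα α z‖) := by
  have h : moebius z.2 (autHol α z.2 y).2 = y.2 := moebius_moebius hz hy
  rw [Near, autHol_autHol α hz hy, h]

/-- Mean value estimate at the scale of the domain. -/
theorem exists_nearVol_mul_sq_le {α : ℝ} (hα : 0 < α) : ∃ C : ℝ, 0 ≤ C ∧ ∀ f : ℂ × ℂ → ℂ,
    DifferentiableOn ℂ f (domain α hα) → MemLp f 2 (Bergman.vol (domain α hα)) →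
    ∀ z ∈ domain α hα, ENNReal.ofReal (nearVol α z) * ‖f z‖ₑ ^ 2 ≤ ENNReal.ofReal C *
      ∫⁻ w in (domain α hα : Set (ℂ × ℂ)) ∩ {w | Near α (1 / 8) (smallRadius α) z w},
        ‖f w‖ₑ ^ 2 := by
  obtain ⟨C₀, hC₀, hbound⟩ := Bergman.exists_norm_le 1 one_pos
  have hs := smallRadius_pos hα
  -- `(4/9)^(α+2)` comes from the lower bound for the Jacobian of `autHol`, valid as `|1 - z̄₂y₂| ≤
  -- 3/2`; `smallRadius α / 1024` comes from `k₁²k₂²` below.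
  set κ : ℝ := (4 / 9) ^ (α + 2) * smallRadius α / 1024 with hκ
  have hκ0 : 0 < κ := by positivity
  refine ⟨C₀ ^ 2 / κ, by positivity, fun f hf hfm z hz => ?_⟩
  set U : Set (ℂ × ℂ) := (domain α hα : Set (ℂ × ℂ)) with hU
  have hUo : IsOpen U := (domain α hα).isOpen
  set N : Set (ℂ × ℂ) := U ∩ {w | Near α (1 / 8) (smallRadius α) z w} with hN
  have hNm : MeasurableSet N := hUo.measurableSet.inter (measurableSet_near _ _ _ _)
  set I := ∫⁻ w in N, ‖f w‖ₑ ^ 2 with hI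
  have hItop : I < ⊤ := by
    have h1 : I ≤ ∫⁻ w in U, ‖f w‖ₑ ^ 2 := lintegral_mono_set inter_subset_left
    refine h1.trans_lt ?_
    rw [← eLpNorm_two_sq]
    exact ENNReal.pow_lt_top hfm.2
  have hz2 := norm_snd_lt_one hz
  have ha := norm_fα_lt_one hz
  have ht := one_sub_sq_norm_pos hz2
  set a := fα α z with hadef
  have hδ : 0 < 1 - ‖a‖ := sub_pos.2 ha
  set k₁ : ℝ := (1 - ‖a‖) / 16 with hk₁
  set k₂ : ℝ := √(smallRadius α * (1 - ‖a‖)) / 2 with hk₂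
  have hk₁0 : 0 < k₁ := by positivity
  have hk₂0 : 0 < k₂ := by positivity
  -- `L` carries the ball of radius `2` into the polydisc and `0` to its centre, so `f ∘ autHol ∘ L`
  -- is holomorphic on a fixed ball, where a fixed local bound applies.
  let L : ℂ × ℂ → ℂ × ℂ := fun x => (a + x.1 * k₁, x.2 * k₂)
  have hL1 : ∀ x ∈ ball (0 : ℂ × ℂ) 2, ‖(L x).1 - a‖ < 1 / 8 * (1 - ‖a‖) ∧
      ‖(L x).2‖ ^ 2 < smallRadius α * (1 - ‖a‖) := by
    intro x hx
    rw [mem_ball_zero_iff, Prod.norm_def, max_lt_iff] at hx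
    simp only [L, add_sub_cancel_left, norm_mul, Complex.norm_real, Real.norm_of_nonneg hk₁0.le,
      Real.norm_of_nonneg hk₂0.le]
    constructor
    · calc ‖x.1‖ * k₁ < 2 * k₁ := by gcongr; exact hx.1
        _ = _ := by rw [hk₁]; ring
    · calc (‖x.2‖ * k₂) ^ 2 < (2 * k₂) ^ 2 := by gcongr; exact hx.2
        _ = _ := by
          rw [hk₂, mul_div_cancel₀ _ two_ne_zero, Real.sq_sqrt (by positivity)]
  set P : Set (ℂ × ℂ) := {y | ‖y.1 - a‖ < 1 / 8 * (1 - ‖a‖) ∧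
    ‖y.2‖ ^ 2 < smallRadius α * (1 - ‖a‖)} with hP
  have hPm : MeasurableSet P :=
    (measurableSet_lt (measurable_fst.sub_const a).norm measurable_const).inter
      (measurableSet_lt (measurable_snd.norm.pow_const 2) measurable_const)
  have hPU : P ⊆ U := fun y hy => polydisc_subset_domain hα ha hy.1 hy.2
  have hPN : ∀ y ∈ P, autHol α z.2 y ∈ N := fun y hy =>
    ⟨autHol_mem_domain hz2 (hPU hy), (near_autHol_iff hz2 (norm_snd_lt_one (hPU hy))).2 hy⟩
  set G : ℂ × ℂ → ENNReal := N.indicator fun w => ‖f w‖ₑ ^ 2 with hG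
  have hGm : Measurable G := by
    have h1 : Measurable (N.indicator f) := by
      have h2 : Measurable (U.indicator f) := by
        classical
        exact hf.continuousOn.measurable_piecewise continuousOn_const hUo.measurableSet
      rw [show N.indicator f = N.indicator (U.indicator f) by
        rw [indicator_indicator, inter_eq_left.2 inter_subset_left]]
      exact h2.indicator hNm
    have h3 : G = fun w => ‖N.indicator f w‖ₑ ^ 2 := by
      funext w
      by_cases hw : w ∈ N <;> simp [hG, hw]
    rw [h3]
    fun_prop
  set h : ℂ × ℂ → ℂ := fun x => f (autHol α z.2 (L x)) with hh
  have hhd : DifferentiableOn ℂ h (ball 0 2) := by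
    intro x hx
    have h1 := hPU (hL1 x hx)
    have h2 : DifferentiableAt ℂ L x := by fun_prop
    have h3 := differentiableAt_autHol (α := α) hz2 (norm_snd_lt_one h1)
    have h4 : DifferentiableAt ℂ f (autHol α z.2 (L x)) :=
      hf.differentiableAt (hUo.mem_nhds (autHol_mem_domain hz2 h1))
    exact (h4.comp x (h3.comp x h2)).differentiableWithinAt
  have hh0 : h 0 = f z := by
    have : L 0 = (a, 0) := by simp [L]
    rw [hh]
    simp only [this, hadef, autHol_fα_zero hz]
  have hint : ENNReal.ofReal (κ * nearVol α z) * ∫⁻ x in ball 0 2, ‖h x‖ₑ ^ 2 ≤ I := by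
    have e1 : ∫⁻ x in ball 0 2, ‖h x‖ₑ ^ 2 ≤
        ∫⁻ x : ℂ × ℂ, (P.indicator fun y => G (autHol α z.2 y)) (a + x.1 * k₁, x.2 * k₂) := by
      rw [← lintegral_indicator measurableSet_ball]
      refine lintegral_mono fun x => ?_
      by_cases hx : x ∈ ball (0 : ℂ × ℂ) 2
      · have h1 : L x ∈ P := hL1 x hx
        have h2 := hPN _ h1
        change _ ≤ P.indicator _ (L x)
        rw [indicator_of_mem hx, indicator_of_mem h1, hG, indicator_of_mem h2]
      · rw [indicator_of_notMem hx]
        exact bot_le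
    have hauto := measurable_autHol α z.2
    have e2 := lintegral_comp_affine (H := P.indicator fun y => G (autHol α z.2 y))
      ((hGm.comp hauto).indicator hPm) a (k₁ := k₁) (k₂ := k₂)
      (by exact_mod_cast hk₁0.ne') (by exact_mod_cast hk₂0.ne')
    have e3 : ENNReal.ofReal ((4 / 9) ^ (α + 2) * (1 - ‖z.2‖ ^ 2) ^ (α + 2)) *
        ∫⁻ y, P.indicator (fun y => G (autHol α z.2 y)) y ≤ I := by
      have hPGm : Measurable (P.indicator fun y => G (autHol α z.2 y)) :=
        (hGm.comp hauto).indicator hPm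
      rw [hI, ← lintegral_indicator hNm, ← hG, ← lintegral_const_mul _ hPGm]
      refine le_trans ?_ (setLIntegral_le_lintegral (univ ×ˢ ball (0 : ℂ) 1) G)
      rw [← lintegral_comp_autHol (α := α) hz2 hGm,
        ← lintegral_indicator (MeasurableSet.univ.prod measurableSet_ball)]
      refine lintegral_mono fun y => ?_
      by_cases hy : y ∈ P
      · have hy2 := norm_snd_lt_one (hPU hy)
        have hyS : y ∈ (univ : Set ℂ) ×ˢ ball (0 : ℂ) 1 := ⟨mem_univ _, mem_ball_zero_iff.2 hy2⟩
        rw [indicator_of_mem hy, indicator_of_mem hyS]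
        gcongr
        have hq : ‖1 - conj z.2 * y.2‖ ≤ 3 / 2 := by
          have h1 := norm_sub_le (1 : ℂ) (conj z.2 * y.2)
          rw [norm_mul, RCLike.norm_conj, norm_one] at h1
          have h2 : ‖y.2‖ ^ 2 ≤ 1 / 4 := by
            have h3 := hy.2
            have := smallRadius_le α
            nlinarith [norm_nonneg a]
          have h3 : ‖y.2‖ ≤ 1 / 2 := by nlinarith [norm_nonneg y.2]
          nlinarith [norm_nonneg y.2, norm_nonneg z.2]
        have hq0 := norm_one_sub_conj_mul_pos hz2 hy2
        rw [← Real.mul_rpow (by norm_num) ht.le]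
        have h4 : 4 / 9 * (1 - ‖z.2‖ ^ 2) ≤ moebiusJac z.2 y.2 := by
          rw [moebiusJac, le_div_iff₀ (by positivity)]
          have : ‖1 - conj z.2 * y.2‖ ^ 2 ≤ 9 / 4 := by nlinarith
          nlinarith
        gcongr
      · rw [indicator_of_notMem hy, mul_zero]
        exact bot_le
    refine le_trans ?_ e3
    rw [← e2, ← mul_assoc, ← ENNReal.ofReal_mul (by positivity)]
    refine mul_le_mul' (ENNReal.ofReal_le_ofReal (le_of_eq ?_)) e1
    rw [Complex.norm_real, Complex.norm_real, Real.norm_of_nonneg hk₁0.le,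
      Real.norm_of_nonneg hk₂0.le, hk₂, div_pow √_, Real.sq_sqrt (by positivity), hκ, nearVol,
      ← hadef, hk₁]
    ring
  have hV := nearVol_pos hz
  -- Since `κ * nearVol α z > 0` and `I` is finite, the preceding bound already forces
  -- square-integrability of `h`.
  have hhtop : ∫⁻ x in ball 0 2, ‖h x‖ₑ ^ 2 < ⊤ := by
    by_contra hcon
    rw [not_lt, top_le_iff] at hcon
    rw [hcon, ENNReal.mul_top (by simpa using by positivity)] at hint
    exact absurd hItop (not_lt.2 hint)
  have hhm : MemLp h 2 (volume.restrict (ball 0 2)) := by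
    refine ⟨hhd.continuousOn.aestronglyMeasurable measurableSet_ball, ?_⟩
    rw [← eLpNorm_two_sq] at hhtop
    exact (ENNReal.pow_lt_top_iff.1 hhtop).resolve_right two_ne_zero
  have hmain := hbound _ isOpen_ball h hhd hhm 0 (closedBall_subset_ball one_lt_two)
  rw [hh0] at hmain
  have hmain2 : ‖f z‖ₑ ^ 2 ≤ ENNReal.ofReal (C₀ ^ 2) * ∫⁻ x in ball 0 2, ‖h x‖ₑ ^ 2 := by
    rw [← eLpNorm_two_sq, ENNReal.ofReal_pow hC₀, ← mul_pow]
    refine pow_le_pow_left' ?_ 2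
    rw [← ofReal_norm, ← ENNReal.ofReal_toReal hhm.2.ne, ← ENNReal.ofReal_mul hC₀]
    exact ENNReal.ofReal_le_ofReal hmain
  calc ENNReal.ofReal (nearVol α z) * ‖f z‖ₑ ^ 2
      ≤ ENNReal.ofReal (nearVol α z) *
        (ENNReal.ofReal (C₀ ^ 2) * ∫⁻ x in ball 0 2, ‖h x‖ₑ ^ 2) := by gcongr
    _ = ENNReal.ofReal (C₀ ^ 2 / κ) *
        (ENNReal.ofReal (κ * nearVol α z) * ∫⁻ x in ball 0 2, ‖h x‖ₑ ^ 2) := by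
        rw [← mul_assoc, ← mul_assoc, ← ENNReal.ofReal_mul hV.le,
          ← ENNReal.ofReal_mul (by positivity)]
        congr 2
        field_simp
    _ ≤ _ := by gcongr

/-! ### Averages over adapted regions. -/

/-- If `moebius a x` is close to `a`, then `x` stays away from the unit circle. So the base
contributes order `(1 - |a|)²`, and the quotient of squared fibre radii contributes one more factor
`1 - |a|`. -/
theorem jac_aut_le {α : ℝ} (hα : 0 < α) {a x : ℂ} (ha : ‖a‖ < 1) (hx : ‖x‖ < 1)
    (h : ‖moebius a x - a‖ < 1 / 2 * (1 - ‖a‖)) :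
    moebiusJac a x ^ 2 * ((1 - ‖moebius a x‖ ^ (2 / α)) / (1 - ‖x‖ ^ (2 / α))) ≤
      1600 * max 1 (2 / α) / min 1 (2 / α) * (1 - ‖a‖) ^ 3 := by
  have hβ : 0 < 2 / α := by positivity
  have hm := norm_moebius_lt_one ha hx
  have ht := one_sub_sq_norm_pos ha
  have hδ : 0 < 1 - ‖a‖ := sub_pos.2 ha
  have hq := norm_one_sub_conj_mul_pos ha hm
  set q' := ‖1 - conj a * moebius a x‖ with hq'
  have hprod : ‖1 - conj a * x‖ * q' = 1 - ‖a‖ ^ 2 := by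
    rw [hq', ← norm_mul, one_sub_conj_mul_moebius ha hx, Complex.norm_real,
      Real.norm_of_nonneg ht.le]
  have hq1 : q' ≤ 5 / 2 * (1 - ‖a‖) := by
    have e : 1 - conj a * moebius a x = ((1 - ‖a‖ ^ 2 : ℝ) : ℂ) -
        conj a * (moebius a x - a) := by
      have h4 : conj a * a = (‖a‖ : ℂ) ^ 2 := Complex.conj_mul' a
      push_cast
      rw [← h4]
      ring
    rw [hq', e]
    refine (norm_sub_le _ _).trans ?_
    rw [Complex.norm_real, Real.norm_of_nonneg ht.le, norm_mul, RCLike.norm_conj]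
    nlinarith [norm_nonneg a, norm_nonneg (moebius a x - a)]
  have hjac : moebiusJac a x = q' ^ 2 / (1 - ‖a‖ ^ 2) := by
    rw [moebiusJac, ← hprod]
    have := norm_one_sub_conj_mul_pos ha hx
    field_simp
  have hδt : 1 - ‖a‖ ≤ 1 - ‖a‖ ^ 2 := by nlinarith [norm_nonneg a]
  have hjac1 : moebiusJac a x ≤ 25 / 4 * (1 - ‖a‖) := by
    rw [hjac, div_le_iff₀ ht]
    have : q' ^ 2 ≤ (5 / 2 * (1 - ‖a‖)) ^ 2 := by gcongr
    nlinarith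
  have hma := norm_le_norm_add_norm_sub' (moebius a x) a
  have hma' := norm_le_norm_add_norm_sub' a (moebius a x)
  rw [norm_sub_rev] at hma'
  have hnum := one_sub_rpow_le_max_mul hβ (norm_nonneg (moebius a x)) hm.le
  have hden := min_mul_le_one_sub_rpow hβ (norm_nonneg x) hx.le
  have hx1 : 1 / 25 ≤ 1 - ‖x‖ := by
    have e := one_sub_sq_norm_moebius ha hm
    rw [moebius_moebius ha hx, ← hq'] at e
    have e2 : 2 / 25 ≤ 1 - ‖x‖ ^ 2 := by
      rw [e, le_div_iff₀ (by positivity)]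
      have h1 : q' ^ 2 ≤ (5 / 2 * (1 - ‖a‖)) ^ 2 := by gcongr
      have h2 : 1 / 2 * (1 - ‖a‖) ≤ 1 - ‖moebius a x‖ ^ 2 := by
        nlinarith [norm_nonneg (moebius a x)]
      have h3 : (1 - ‖a‖) * (1 / 2 * (1 - ‖a‖)) ≤ (1 - ‖a‖ ^ 2) * (1 - ‖moebius a x‖ ^ 2) := by
        gcongr
      nlinarith
    nlinarith [norm_nonneg x]
  have hmin : 0 < min 1 (2 / α) := by positivity
  have hmax : 0 < max 1 (2 / α) := by positivity
  have hden1 : min 1 (2 / α) * (1 / 25) ≤ 1 - ‖x‖ ^ (2 / α) :=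
    (mul_le_mul_of_nonneg_left hx1 hmin.le).trans hden
  have hnum1 : 1 - ‖moebius a x‖ ^ (2 / α) ≤ max 1 (2 / α) * (3 / 2 * (1 - ‖a‖)) :=
    hnum.trans (mul_le_mul_of_nonneg_left (by linarith) hmax.le)
  have hJ := moebiusJac_pos ha hx
  have hpos := one_sub_rpow_pos hα (norm_nonneg _) hm
  have hpos' := one_sub_rpow_pos hα (norm_nonneg _) hx
  have hquot := (div_pos hpos hpos').le
  calc _ ≤ (25 / 4 * (1 - ‖a‖)) ^ 2 *
        (max 1 (2 / α) * (3 / 2 * (1 - ‖a‖)) / (min 1 (2 / α) * (1 / 25))) := by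
        gcongr
    _ = 46875 / 32 * (max 1 (2 / α) / min 1 (2 / α) * (1 - ‖a‖) ^ 3) := by
        field_simp
        ring
    _ ≤ 1600 * (max 1 (2 / α) / min 1 (2 / α) * (1 - ‖a‖) ^ 3) := by
        gcongr
        norm_num
    _ = _ := by ring

/-- Averages over `{z | Near α (1 / 2) (2 * smallRadius α) w z}` are controlled by integrals of
the translated function. -/
theorem exists_lintegral_near_le {α : ℝ} (hα : 0 < α) : ∃ C : ℝ, 0 ≤ C ∧
    ∀ v : ℂ × ℂ → ENNReal, Measurable v → ∀ w ∈ domain α hα,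
      ∫⁻ z in (domain α hα : Set (ℂ × ℂ)) ∩ {z | Near α (1 / 2) (2 * smallRadius α) w z}, v z ≤
        ENNReal.ofReal (C * nearVol α w) * ∫⁻ x in domain α hα, v (translation α w x) := by
  set K : ℝ := 1600 * max 1 (2 / α) / min 1 (2 / α) with hK
  refine ⟨4 ^ (α + 2) * K, by positivity, fun v hv w hw => ?_⟩
  set U : Set (ℂ × ℂ) := (domain α hα : Set (ℂ × ℂ)) with hU
  have hUm : MeasurableSet U := (domain α hα).isOpen.measurableSet
  set N : Set (ℂ × ℂ) := U ∩ {z | Near α (1 / 2) (2 * smallRadius α) w z} with hN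
  have hNm : MeasurableSet N := hUm.inter (measurableSet_near _ _ _ _)
  have hc := norm_snd_lt_one hw
  have ha := norm_fα_lt_one hw
  have ht := one_sub_sq_norm_pos hc
  set a := fα α w with hadef
  set c := w.2 with hcdef
  have hδ : 0 < 1 - ‖a‖ := sub_pos.2 ha
  set g : ℂ × ℂ → ENNReal := N.indicator v with hg
  have hgm : Measurable g := hv.indicator hNm
  have hgφ : Measurable fun y => g (autHol α c y) := hgm.comp (measurable_autHol α c)
  -- The cut-off to `U` allows passing from the cylinder `univ ×ˢ ball`, where `autHol` changes
  -- variables, to `ball ×ˢ univ`, where `aut` does.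
  set g₁ : ℂ × ℂ → ENNReal := U.indicator fun y => g (autHol α c y) with hg₁
  have hg₁m : Measurable g₁ := hgφ.indicator hUm
  have hS : MeasurableSet ((univ : Set ℂ) ×ˢ ball (0 : ℂ) 1) :=
    MeasurableSet.univ.prod measurableSet_ball
  have hS' : MeasurableSet (ball (0 : ℂ) 1 ×ˢ (univ : Set ℂ)) :=
    measurableSet_ball.prod MeasurableSet.univ
  have hvτ : Measurable fun x => v (translation α w x) :=
    hv.comp ((measurable_autHol α c).comp (measurable_aut α a))
  have step1 : ∫⁻ z in N, v z ≤
      ENNReal.ofReal (4 ^ (α + 2) * (1 - ‖c‖ ^ 2) ^ (α + 2)) * ∫⁻ y, g₁ y := by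
    have e : ∫⁻ z in N, v z = ∫⁻ z in (univ : Set ℂ) ×ˢ ball (0 : ℂ) 1, g z := by
      rw [← lintegral_indicator hS, ← lintegral_indicator hNm, hg, indicator_indicator,
        inter_eq_right.2]
      exact fun z hz => ⟨mem_univ _, mem_ball_zero_iff.2 (norm_snd_lt_one hz.1)⟩
    rw [e, ← lintegral_comp_autHol (α := α) hc hgm, ← lintegral_indicator hS,
      ← lintegral_const_mul _ hg₁m]
    refine lintegral_mono fun y => ?_
    by_cases hy : y ∈ (univ : Set ℂ) ×ˢ ball (0 : ℂ) 1
    swap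
    · rw [indicator_of_notMem hy]
      exact bot_le
    rw [indicator_of_mem hy]
    have hy2 : ‖y.2‖ < 1 := mem_ball_zero_iff.1 hy.2
    by_cases hyN : autHol α c y ∈ N
    swap
    · simp only [hg, indicator_of_notMem hyN, mul_zero]
      exact bot_le
    have hyU : y ∈ U := by
      have := autHol_mem_domain hc hyN.1
      rwa [autHol_autHol α hc hy2] at this
    have hnear := (near_autHol_iff hc hy2).1 hyN.2
    rw [hg₁, indicator_of_mem hyU]
    gcongr
    rw [← Real.mul_rpow (by norm_num) ht.le]
    have hJ := moebiusJac_pos hc hy2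
    -- Nearness gives `|y.2| ≤ 1/2`, hence `|1 - c̄ y₂| ≥ 1/2`; this is the source of `4^(α+2)`.
    have h1 : moebiusJac c y.2 ≤ 4 * (1 - ‖c‖ ^ 2) := by
      have h2 := norm_sub_norm_le (1 : ℂ) (conj c * y.2)
      rw [norm_mul, RCLike.norm_conj, norm_one] at h2
      have h3 : ‖y.2‖ ^ 2 ≤ 1 / 4 := by
        have h3 := hnear.2
        rw [← hadef] at h3
        have := smallRadius_le α
        have := smallRadius_pos hα
        nlinarith [norm_nonneg a]
      have h4 : ‖y.2‖ ≤ 1 / 2 := by nlinarith [norm_nonneg y.2]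
      have h5 : 1 / 2 ≤ ‖1 - conj c * y.2‖ := by nlinarith [norm_nonneg y.2, norm_nonneg c]
      rw [moebiusJac, div_le_iff₀ (by positivity)]
      have h6 : 1 / 4 ≤ ‖1 - conj c * y.2‖ ^ 2 := by nlinarith
      nlinarith
    gcongr
  have step2 : ∫⁻ y, g₁ y ≤ ENNReal.ofReal (K * (1 - ‖a‖) ^ 3) *
      ∫⁻ x in U, v (translation α w x) := by
    have e : ∫⁻ y, g₁ y = ∫⁻ y in ball (0 : ℂ) 1 ×ˢ (univ : Set ℂ), g₁ y := by
      rw [← lintegral_indicator hS', hg₁, indicator_indicator, inter_eq_right.2]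
      exact fun z hz => ⟨mem_ball_zero_iff.2 (norm_fst_lt_one hz), mem_univ _⟩
    rw [e, ← lintegral_comp_aut hα ha hg₁m, ← lintegral_indicator hS',
      ← lintegral_const_mul _ hvτ, ← lintegral_indicator hUm]
    refine lintegral_mono fun x => ?_
    by_cases hx : x ∈ ball (0 : ℂ) 1 ×ˢ (univ : Set ℂ)
    swap
    · rw [indicator_of_notMem hx]
      exact bot_le
    rw [indicator_of_mem hx]
    have hx1 : ‖x.1‖ < 1 := mem_ball_zero_iff.1 hx.1
    by_cases hyU : aut α a x ∈ U
    swap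
    · simp only [hg₁, indicator_of_notMem hyU, mul_zero]
      exact bot_le
    by_cases hyN : autHol α c (aut α a x) ∈ N
    swap
    · simp only [hg₁, indicator_of_mem hyU, hg, indicator_of_notMem hyN, mul_zero]
      exact bot_le
    have hxU : x ∈ U := by
      have := aut_mem_domain ha hyU
      rwa [aut_aut hα ha hx1] at this
    have hnear := (near_autHol_iff hc (norm_snd_lt_one hyU)).1 hyN.2
    simp only [hg₁, indicator_of_mem hyU, hg, indicator_of_mem hyN, indicator_of_mem hxU]
    exact mul_le_mul' (ENNReal.ofReal_le_ofReal (jac_aut_le hα ha hx1 hnear.1)) le_rfl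
  refine step1.trans ((mul_le_mul' le_rfl step2).trans (le_of_eq ?_))
  rw [← mul_assoc, ← ENNReal.ofReal_mul (by positivity)]
  congr 2
  rw [nearVol]
  ring

end Thullen

/-! ### From Carleson measures to Toeplitz operators. -/

namespace Bergman

theorem enorm_eq_eLpNorm_toFun {Ω : TopologicalSpace.Opens (ℂ × ℂ)} (F : space Ω) :
    ‖F‖ₑ = eLpNorm (toFun F) 2 (vol Ω) := by
  rw [← ofReal_norm, norm_eq_toFun, ENNReal.ofReal_toReal (memLp_toFun F).2.ne]

/-- If `|u| dσ` is a Carleson measure for `A²(Ω)`, then `T_u` is bounded. -/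
theorem toeplitzBounded_of_carleson {Ω : TopologicalSpace.Opens (ℂ × ℂ)} {u : ℂ × ℂ → ℂ}
    (hu : AEStronglyMeasurable u (vol Ω)) {C : ENNReal} (hC : C ≠ ⊤)
    (h : ∀ F : space Ω, ∫⁻ w in Ω, ‖toFun F w‖ₑ ^ 2 * ‖u w‖ₑ ≤ C * ‖F‖ₑ ^ 2) :
    ToeplitzBounded Ω u := by
  have hmeas : ∀ F : space Ω, AEStronglyMeasurable (toFun F) (vol Ω) := fun F => (memLp_toFun F).1
  have hbound : ∀ F G : space Ω, ∫⁻ w in Ω, ‖u w * toFun F w * conj (toFun G w)‖ₑ ≤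
      C * ‖F‖ₑ * ‖G‖ₑ := by
    intro F G
    -- Cauchy–Schwarz after giving each of `F` and `G` a factor `|u|^(1/2)`.
    have hH := ENNReal.lintegral_mul_le_Lp_mul_Lq (vol Ω) Real.HolderConjugate.two_two
      (f := fun w => ‖toFun F w‖ₑ * ‖u w‖ₑ ^ (1 / 2 : ℝ))
      (g := fun w => ‖toFun G w‖ₑ * ‖u w‖ₑ ^ (1 / 2 : ℝ))
      ((hmeas F).enorm.mul (hu.enorm.pow_const _)) ((hmeas G).enorm.mul (hu.enorm.pow_const _))
    have hsq : ∀ x y : ENNReal, (x * y ^ (1 / 2 : ℝ)) ^ (2 : ℝ) = x ^ 2 * y := by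
      intro x y
      rw [ENNReal.mul_rpow_of_nonneg _ _ zero_le_two, ← ENNReal.rpow_mul, ENNReal.rpow_two]
      norm_num
    simp only [hsq] at hH
    calc _ = ∫⁻ w in Ω, ((fun w => ‖toFun F w‖ₑ * ‖u w‖ₑ ^ (1 / 2 : ℝ)) *
          fun w => ‖toFun G w‖ₑ * ‖u w‖ₑ ^ (1 / 2 : ℝ)) w := by
          refine lintegral_congr fun w => ?_
          have e : ‖u w‖ₑ = ‖u w‖ₑ ^ (1 / 2 : ℝ) * ‖u w‖ₑ ^ (1 / 2 : ℝ) := by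
            rw [← ENNReal.rpow_add_of_nonneg _ _ (by norm_num) (by norm_num)]
            norm_num
          rw [enorm_mul, enorm_mul, RCLike.enorm_conj, e, Pi.mul_apply]
          ring
      _ ≤ _ := hH
      _ ≤ (C * ‖F‖ₑ ^ 2) ^ (1 / 2 : ℝ) * (C * ‖G‖ₑ ^ 2) ^ (1 / 2 : ℝ) := by
          gcongr
          · exact h F
          · exact h G
      _ = ((C * ‖F‖ₑ * ‖G‖ₑ) ^ (2 : ℝ)) ^ (1 / 2 : ℝ) := by
          rw [← ENNReal.mul_rpow_of_nonneg _ _ (by norm_num), ENNReal.rpow_two]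
          congr 1
          ring
      _ = _ := by
          rw [← ENNReal.rpow_mul]
          norm_num
  have hint : ∀ F G : space Ω,
      Integrable (fun w => u w * toFun F w * conj (toFun G w)) (vol Ω) := by
    intro F G
    refine ⟨(hu.mul (hmeas F)).mul (RCLike.continuous_conj.comp_aestronglyMeasurable (hmeas G)), ?_⟩
    refine (hbound F G).trans_lt ?_
    exact ENNReal.mul_lt_top (ENNReal.mul_lt_top hC.lt_top enorm_lt_top) enorm_lt_top
  have hint' : ∀ F G : space Ω,
      Integrable (fun w => conj (u w * toFun F w) * toFun G w) (vol Ω) := by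
    intro F G
    refine (RCLike.conjCLE.toContinuousLinearMap.integrable_comp (hint F G)).congr ?_
    filter_upwards with w
    simp
  refine ⟨fun f z => hint f (kernel z), ?_⟩
  have hΩ := Ω.isOpen.measurableSet
  -- The form is the conjugate of `∫ u F Ḡ`, matching the convention that inner products are
  -- conjugate-linear in the first entry.
  let B₀ : space Ω →ₗ⋆[ℂ] space Ω →ₗ[ℂ] ℂ :=
    LinearMap.mk₂'ₛₗ (starRingEnd ℂ) (RingHom.id ℂ)
      (fun F G => ∫ w in Ω, conj (u w * toFun F w) * toFun G w)
      (fun F F' G => by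
        rw [← integral_add (hint' F G) (hint' F' G)]
        refine setIntegral_congr_fun hΩ fun w hw => ?_
        simp only [toFun_add F F' hw, map_mul, map_add]
        ring)
      (fun c F G => by
        rw [smul_eq_mul, ← integral_const_mul]
        refine setIntegral_congr_fun hΩ fun w hw => ?_
        simp only [toFun_smul c F hw, map_mul]
        ring)
      (fun F G G' => by
        rw [← integral_add (hint' F G) (hint' F G')]
        refine setIntegral_congr_fun hΩ fun w hw => ?_
        simp only [toFun_add G G' hw]
        ring)
      (fun c F G => by
        rw [smul_eq_mul, ← integral_const_mul]
        refine setIntegral_congr_fun hΩ fun w hw => ?_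
        simp only [toFun_smul c G hw, RingHom.id_apply]
        ring)
  let B : space Ω →L⋆[ℂ] space Ω →L[ℂ] ℂ := B₀.mkContinuous₂ C.toReal (by
    intro F G
    have h1 : ‖∫ w in Ω, conj (u w * toFun F w) * toFun G w‖ₑ ≤ C * ‖F‖ₑ * ‖G‖ₑ := by
      refine (enorm_integral_le_lintegral_enorm _).trans (le_trans (le_of_eq ?_) (hbound F G))
      refine lintegral_congr fun w => ?_
      simp only [enorm_mul, RCLike.enorm_conj]
    have h2 := ENNReal.toReal_mono (by finiteness) h1
    simp only [ENNReal.toReal_mul, toReal_enorm] at h2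
    exact h2)
  -- The representing operator satisfies `⟨T F, G⟩ = B F G`. Taking `G = kernel z` recovers the
  -- integral defining `T_u`.
  refine ⟨InnerProductSpace.continuousLinearMapOfBilin B, fun f z => ?_⟩
  rw [← inner_kernel, ← inner_conj_symm (𝕜 := ℂ) (kernel z),
    InnerProductSpace.continuousLinearMapOfBilin_apply]
  change conj (∫ w in Ω, conj (u w * toFun f w) * toFun (kernel z) w) = _
  rw [← integral_conj, toeplitz]
  refine setIntegral_congr_fun hΩ fun w _ => ?_
  simp only [map_mul, Complex.conj_conj, projIntegrand]

end Bergman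

/-! ### The Carleson bound and the conclusion. -/

namespace Thullen

theorem measurable_nearVol (α : ℝ) : Measurable (nearVol α) := by
  unfold nearVol fα
  fun_prop

/-- A weight whose translates have uniformly bounded integrals is a Carleson weight. -/
theorem exists_carleson_bound {α : ℝ} (hα : 0 < α) : ∃ C : ℝ, 0 ≤ C ∧
    ∀ (v : ℂ × ℂ → ENNReal) (M : ENNReal), Measurable v →
      (∀ w ∈ domain α hα, ∫⁻ x in domain α hα, v (translation α w x) ≤ M) →
      ∀ f : ℂ × ℂ → ℂ, DifferentiableOn ℂ f (domain α hα) →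
        MemLp f 2 (Bergman.vol (domain α hα)) →
        ∫⁻ z in domain α hα, ‖f z‖ₑ ^ 2 * v z ≤
          ENNReal.ofReal C * M * ∫⁻ z in domain α hα, ‖f z‖ₑ ^ 2 := by
  obtain ⟨A, hA, hmv⟩ := exists_nearVol_mul_sq_le hα
  obtain ⟨B, hB, hav⟩ := exists_lintegral_near_le hα
  set K : ℝ := 4 ^ (α + 2) * 8 with hK
  have hK0 : 0 < K := by positivity
  refine ⟨A * K * B, by positivity, fun v M hv hM f hf hfm => ?_⟩
  set U : Set (ℂ × ℂ) := (domain α hα : Set (ℂ × ℂ)) with hU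
  have hUm : MeasurableSet U := (domain α hα).isOpen.measurableSet
  set V : ℂ × ℂ → ENNReal := fun z => ENNReal.ofReal (nearVol α z) with hVdef
  have hVm : Measurable V := (measurable_nearVol α).ennreal_ofReal
  have hV0 : ∀ z ∈ U, V z ≠ 0 := fun z hz => by simpa [hVdef] using nearVol_pos (hα := hα) hz
  have hVtop : ∀ z, V z ≠ ⊤ := fun z => ENNReal.ofReal_ne_top
  -- `f` is controlled only on `U`; its extension by zero is measurable everywhere, as the exchange
  -- of integrals requires.
  set f₀ : ℂ × ℂ → ℂ := U.indicator f with hf₀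
  have hf₀m : Measurable f₀ := by
    classical
    exact hf.continuousOn.measurable_piecewise continuousOn_const hUm
  set F : ℂ × ℂ → ENNReal := fun w => (V w)⁻¹ * ‖f₀ w‖ₑ ^ 2 with hF
  have hFm : Measurable F := by fun_prop
  set k : ℂ × ℂ → ℂ × ℂ → ENNReal := fun z w =>
    {p : (ℂ × ℂ) × (ℂ × ℂ) | Near α (1 / 2) (2 * smallRadius α) p.1 p.2}.indicator 1 (w, z)
    with hk
  have hkm : Measurable (Function.uncurry k) :=
    (measurable_one.indicator (measurableSet_near_prod _ _ _)).comp measurable_swap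
  -- The mean value estimate with the roles of `z` and `w` exchanged: the kernel tests nearness of
  -- `z` to `w`, and the weight is `1 / V w` instead of `1 / V z`.
  have hpt : ∀ z ∈ U, ‖f z‖ₑ ^ 2 ≤ ENNReal.ofReal (A * K) * ∫⁻ w in U, k z w * F w := by
    intro z hz
    have h1 : V z * ‖f z‖ₑ ^ 2 ≤ V z * (ENNReal.ofReal (A * K) * ∫⁻ w in U, k z w * F w) := by
      refine (hmv f hf hfm z hz).trans ?_
      rw [mul_left_comm, ENNReal.ofReal_mul hA, mul_assoc]
      refine mul_le_mul' le_rfl ?_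
      rw [← lintegral_const_mul' _ _ (hVtop z), ← lintegral_const_mul' _ _ ENNReal.ofReal_ne_top,
        ← lintegral_indicator (hUm.inter (measurableSet_near _ _ _ _)), ← lintegral_indicator hUm]
      refine lintegral_mono fun w => ?_
      by_cases hw : w ∈ U ∩ {w | Near α (1 / 8) (smallRadius α) z w}
      swap
      · rw [indicator_of_notMem hw]
        exact bot_le
      obtain ⟨hs1, hs2⟩ := Near.symm hz hw.1 hw.2
      have hkz : k z w = 1 := by
        rw [hk]
        exact indicator_of_mem (s := {p : (ℂ × ℂ) × (ℂ × ℂ) |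
          Near α (1 / 2) (2 * smallRadius α) p.1 p.2}) hs1 1
      have hVw : V w ≤ ENNReal.ofReal K * V z := by
        rw [hVdef, ← ENNReal.ofReal_mul hK0.le]
        exact ENNReal.ofReal_le_ofReal hs2
      rw [indicator_of_mem hw, indicator_of_mem hw.1, hkz, one_mul, hF]
      simp only [hf₀, indicator_of_mem hw.1]
      calc ‖f w‖ₑ ^ 2 = V w * ((V w)⁻¹ * ‖f w‖ₑ ^ 2) := by
            rw [← mul_assoc, ENNReal.mul_inv_cancel (hV0 w hw.1) (hVtop w), one_mul]
        _ ≤ ENNReal.ofReal K * V z * ((V w)⁻¹ * ‖f w‖ₑ ^ 2) := by gcongr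
        _ = _ := by ring
    exact (ENNReal.mul_le_mul_iff_right (hV0 z hz) (hVtop z)).1 h1
  -- The average of `v` over the region around `w` produces `V w`, which cancels the `1 / V w` in
  -- `F`.
  have hinner : ∀ w ∈ U, ∫⁻ z in U, k z w * F w * v z ≤
      ENNReal.ofReal B * M * ‖f w‖ₑ ^ 2 := by
    intro w hw
    have e : ∀ z, k z w * F w * v z =
        F w * {z | Near α (1 / 2) (2 * smallRadius α) w z}.indicator v z := by
      intro z
      have hkz : k z w = {z | Near α (1 / 2) (2 * smallRadius α) w z}.indicator 1 z := rfl
      rw [hkz, mul_right_comm, ← indicator_mul_left, mul_comm]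
      simp only [Pi.one_apply, one_mul]
    have hN := measurableSet_near α (1 / 2) (2 * smallRadius α) w
    simp only [e]
    rw [lintegral_const_mul _ (hv.indicator hN), lintegral_indicator hN,
      Measure.restrict_restrict hN, inter_comm]
    calc F w * _ ≤ F w * (ENNReal.ofReal (B * nearVol α w) * M) := by
          gcongr
          exact (hav v hv w hw).trans (by gcongr; exact hM w hw)
      _ = ENNReal.ofReal B * M * ‖f w‖ₑ ^ 2 * (V w * (V w)⁻¹) := by
          simp only [hF, hf₀, indicator_of_mem hw, ENNReal.ofReal_mul hB, hVdef]
          ring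
      _ = _ := by rw [ENNReal.mul_inv_cancel (hV0 w hw) (hVtop w), mul_one]
  calc ∫⁻ z in U, ‖f z‖ₑ ^ 2 * v z
      ≤ ∫⁻ z in U, ENNReal.ofReal (A * K) * ∫⁻ w in U, k z w * F w * v z := by
        refine setLIntegral_mono' hUm fun z hz => ?_
        rw [lintegral_mul_const _ (by fun_prop), ← mul_assoc]
        exact mul_le_mul' (hpt z hz) le_rfl
    _ = ENNReal.ofReal (A * K) * ∫⁻ w in U, ∫⁻ z in U, k z w * F w * v z := by
        rw [lintegral_const_mul' _ _ ENNReal.ofReal_ne_top, lintegral_lintegral_swap]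
        have h1 : Measurable fun p : (ℂ × ℂ) × (ℂ × ℂ) =>
            Function.uncurry k p * F p.2 * v p.1 := by fun_prop
        exact h1.aemeasurable
    _ ≤ ENNReal.ofReal (A * K) * ∫⁻ w in U, ENNReal.ofReal B * M * ‖f w‖ₑ ^ 2 := by
        gcongr 1
        exact setLIntegral_mono' hUm hinner
    _ = _ := by
        have hfm' : AEMeasurable (fun w => ‖f w‖ₑ ^ 2) (volume.restrict U) :=
          hfm.1.enorm.pow_const 2
        rw [lintegral_const_mul'' _ hfm', ENNReal.ofReal_mul (by positivity : 0 ≤ A * K)]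
        ring

/-- Hölder on a domain of finite volume bounds the `L¹` norms of all translates of `u` uniformly, so
`|u|` is a Carleson weight. -/
theorem toeplitzBounded_of_supNorm_lt_top {α : ℝ} (hα : 0 < α) {u : ℂ × ℂ → ℂ}
    (hu : AEStronglyMeasurable u (Bergman.vol (domain α hα))) {p : ENNReal} (hp : 1 ≤ p)
    (h : supNorm α hα u p < ⊤) : Bergman.ToeplitzBounded (domain α hα) u := by
  obtain ⟨C, hC, hcarl⟩ := exists_carleson_bound hα
  set U := domain α hα with hU
  set M : ENNReal := supNorm α hα u p *
    (volume (U : Set (ℂ × ℂ))) ^ (1 / (1 : ENNReal).toReal - 1 / p.toReal) with hMdef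
  have hexp : 0 ≤ 1 / (1 : ENNReal).toReal - 1 / p.toReal := by
    rcases eq_or_ne p ⊤ with rfl | hpt
    · simp
    · have : 1 ≤ p.toReal := by
        rw [← ENNReal.toReal_one]
        exact ENNReal.toReal_mono hpt hp
      rw [ENNReal.toReal_one, sub_nonneg, div_one]
      exact div_le_one_of_le₀ this (by linarith)
  have hMtop : M ≠ ⊤ := ENNReal.mul_ne_top h.ne
    (ENNReal.rpow_ne_top_of_nonneg hexp (volume_domain_lt_top hα).ne)
  -- The Carleson bound wants a measurable weight, so `u` is replaced by a measurable
  -- representative. Translations pull null sets back to null sets, so the translates agree almost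
  -- everywhere.
  have htrans : ∀ w ∈ U, ∫⁻ x in U, ‖hu.mk u (translation α w x)‖ₑ ≤ M := by
    intro w hw
    have hq := quasiMeasurePreserving_translation hα hw
    have e : ∫⁻ x in U, ‖hu.mk u (translation α w x)‖ₑ =
        eLpNorm (fun x => u (translation α w x)) 1 (Bergman.vol U) := by
      rw [eLpNorm_one_eq_lintegral_enorm]
      refine lintegral_congr_ae ?_
      filter_upwards [hq.ae_eq_comp hu.ae_eq_mk] with x hx
      simp only [Function.comp_apply] at hx
      rw [hx]
    rw [e]
    refine (eLpNorm_le_eLpNorm_mul_rpow_measure_univ hp (hu.comp_quasiMeasurePreserving hq)).trans ?_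
    rw [hMdef, Measure.restrict_apply_univ]
    gcongr
    exact le_iSup₂ (f := fun z (_ : z ∈ domain α hα) =>
      eLpNorm (fun w => u (translation α z w)) p (Bergman.vol (domain α hα))) w hw
  refine Bergman.toeplitzBounded_of_carleson hu (C := ENNReal.ofReal C * M)
    (ENNReal.mul_ne_top ENNReal.ofReal_ne_top hMtop) fun F => ?_
  rw [Bergman.enorm_eq_eLpNorm_toFun, eLpNorm_two_sq]
  refine le_trans (le_of_eq (lintegral_congr_ae ?_))
    (hcarl (fun w => ‖hu.mk u w‖ₑ) M hu.stronglyMeasurable_mk.measurable.enorm htrans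
      (Bergman.toFun F) (Bergman.differentiableOn_toFun F) (Bergman.memLp_toFun F))
  filter_upwards [hu.ae_eq_mk] with w hw
  rw [hw]

/-- Composition with a translation cannot raise the essential supremum, since null sets pull back to
null sets; finite volume then handles every `p` with a bound independent of `z`. -/
theorem supNorm_lt_top_of_memLp_top {α : ℝ} (hα : 0 < α) {u : ℂ × ℂ → ℂ}
    (hu : MemLp u ⊤ (Bergman.vol (domain α hα))) (p : ENNReal) : supNorm α hα u p < ⊤ := by
  have hfin : eLpNorm u ⊤ (Bergman.vol (domain α hα)) *
      (volume (domain α hα : Set (ℂ × ℂ))) ^ (1 / p.toReal - 1 / (⊤ : ENNReal).toReal) < ⊤ := by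
    refine ENNReal.mul_lt_top hu.2 (ENNReal.rpow_lt_top_of_nonneg ?_ (volume_domain_lt_top hα).ne)
    simp
  refine lt_of_le_of_lt (iSup₂_le fun z hz => ?_) hfin
  have hq := quasiMeasurePreserving_translation hα hz
  refine (eLpNorm_le_eLpNorm_mul_rpow_measure_univ le_top
    (hu.1.comp_quasiMeasurePreserving hq)).trans ?_
  rw [Measure.restrict_apply_univ]
  gcongr
  rw [eLpNorm_exponent_top, eLpNorm_exponent_top]
  refine essSup_le_of_ae_le _ ?_
  exact hq.ae (enorm_ae_le_eLpNormEssSup u _)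

end Thullen

theorem corollary3p2 (α : ℝ) (hα : 0 < α) (hα1 : α ≠ 1) :
    (∀ u : ℂ × ℂ → ℂ, AEStronglyMeasurable u (Bergman.vol (Thullen.domain α hα)) →
      (∃ p : ENNReal, 4 < p ∧ Thullen.supNorm α hα u p < ⊤) →
        Bergman.ToeplitzBounded (Thullen.domain α hα) u) ∧
    (∀ u : ℂ × ℂ → ℂ, MemLp u ⊤ (Bergman.vol (Thullen.domain α hα)) →
      (∀ p : ENNReal, 4 < p → Thullen.supNorm α hα u p < ⊤) ∧
        Bergman.ToeplitzBounded (Thullen.domain α hα) u) := by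
  refine ⟨?_, fun u hu => ⟨fun p _ => Thullen.supNorm_lt_top_of_memLp_top hα hu p, ?_⟩⟩
  · rintro u hu ⟨p, hp, h⟩
    exact Thullen.toeplitzBounded_of_supNorm_lt_top hα hu
      (le_trans (by norm_num) hp.le) h
  · exact Thullen.toeplitzBounded_of_supNorm_lt_top hα hu.1 le_top
      (Thullen.supNorm_lt_top_of_memLp_top hα hu ⊤)
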